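/- Let $k$ be a field. An affine algebraic $k$-group scheme $G$ is a functor $R \mapsto \operatorname{Hom}_{k\text{-alg}}(k[G],R)$ on commutative $k$-algebras, where $k[G]$ is a finitely generated commutative Hopf algebra over $k$; its closed subgroup schemes $H$ correspond to the Hopf ideals $I_H \subseteq k[G]$, with $k[H]=k[G]/I_H$. For a closed subgroup scheme $H\subseteq G$, the centralizer $C_G(H)$ is the closed subgroup scheme of $G$ with $$C_G(H)(R)=\{g\in G(R) \mid h\,g_r\,h^{-1}=g_r \text{ for every } k\text{-algebra homomorphism } r:R\to R' \text{ and every } h\in H(R')\},$$ where $g_r$ is the image of $g$ in $G(R')$. Let $G$ and $G'$ be smooth affine algebraic $k$-group schemes, and let $\pi:G\to G'$ be a morphism of $k$-group schemes with comorphism $\pi^*:k[G']\to k[G]$. Suppose that $\pi$ is a central separable isogeny, i.e. $\pi^*$ is injective and the scheme-theoretic kernel $\ker\pi$ is finite over $k$, smooth over $k$, and contained in the center $Z(G)=C_G(G)$. For a closed subgroup scheme $H\subseteq G$ with ideal $I_H$, let $\pi H\subseteq G'$ be the closed subgroup scheme with ideal $(\pi^*)^{-1}(I_H)$. Then: 1.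 For every closed subgroup scheme $H\subseteq G$, the centralizer $C_G(H)$ is smooth over $k$ if and only if $C_{G'}(\pi H)$ is smooth over $k$. 2. $C_G(H)$ is smooth over $k$ for every closed subgroup scheme $H\subseteq G$ if and only if $C_{G'}(H')$ is smooth over $k$ for every closed subgroup scheme $H'\subseteq G'$. -/

import Mathlib

universe u

open scoped TensorProduct

/-!
An affine algebraic group scheme `G` over a field `k` is given by its coordinate ring `A = k[G]`,
a finitely generated commutative Hopf algebra over `k`; as a functor it is `R ↦ Hom(A, R)`.
-/

namespace AffGrp

/-- The set `G(R)` of `R`-points of the group scheme `G` with coordinate ring `A`.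
Its multiplication is the convolution product, i.e. the group law of `G(R)`. -/
abbrev Points (k A R : Type u) [Field k] [CommRing A] [HopfAlgebra k A] [CommRing R]
    [Algebra k R] : Type u :=
  WithConv (A →ₐ[k] R)

section Points

variable {k A B R R' : Type u} [Field k] [CommRing A] [HopfAlgebra k A] [CommRing B]
  [HopfAlgebra k B] [CommRing R] [Algebra k R] [CommRing R'] [Algebra k R']

/-- The map `G(R) → G(R')`, `x ↦ x_r`, induced by a homomorphism `r : R → R'` of `k`-algebras. -/
def Points.map (r : R →ₐ[k] R') (x : Points k A R) : Points k A R' :=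
  WithConv.toConv (r.comp x.ofConv)

/-- The map `G(R) → G'(R)` induced by a morphism `G → G'` of group schemes with comorphism
`π : k[G'] → k[G]`. -/
def Points.push (π : B →ₐc[k] A) (x : Points k A R) : Points k B R :=
  WithConv.toConv (x.ofConv.comp (π : B →ₐ[k] A))

/-- The inverse of a point of `G`. -/
noncomputable def Points.inverse (x : Points k A R) : Points k A R :=
  WithConv.toConv (x.ofConv.comp (HopfAlgebra.antipodeAlgHom k A))

theorem Points.map_mul (r : R →ₐ[k] R') (x y : Points k A R) :
    (x * y).map r = x.map r * y.map r :=
  WithConv.ofConv_injective (AlgHom.comp_convMul_distrib r x y)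

theorem Points.map_one (r : R →ₐ[k] R') : (1 : Points k A R).map r = 1 := by
  apply WithConv.ofConv_injective
  ext a
  change r (algebraMap k R (Coalgebra.counit a)) = algebraMap k R' (Coalgebra.counit a)
  simp

theorem Points.push_mul (π : B →ₐc[k] A) (x y : Points k A R) :
    (x * y).push π = x.push π * y.push π :=
  WithConv.ofConv_injective (AlgHom.convMul_comp_bialgHom_distrib x y π)

theorem Points.push_one (π : B →ₐc[k] A) : (1 : Points k A R).push π = 1 := by
  apply WithConv.ofConv_injective
  ext b
  change algebraMap k R (Coalgebra.counit (π b)) = algebraMap k R (Coalgebra.counit b)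
  simp

theorem Points.inverse_mul (x : Points k A R) : x.inverse * x = 1 := by
  have h := congrArg (Points.map x.ofConv) (AlgHom.antipode_id_cancel (R := k) (A := A))
  rw [Points.map_mul, Points.map_one] at h
  exact h

theorem id_mul_antipode_eq_one : WithConv.toConv (AlgHom.id k A) *
    WithConv.toConv (HopfAlgebra.antipodeAlgHom k A) = (1 : Points k A A) := by
  apply WithConv.ofConv_injective
  apply AlgHom.toLinearMap_injective
  apply WithConv.toConv_injective
  rw [AlgHom.toLinearMap_convMul, AlgHom.toLinearMap_convOne]
  simp [LinearMap.id_mul_antipode]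

theorem Points.mul_inverse (x : Points k A R) : x * x.inverse = 1 := by
  have h := congrArg (Points.map x.ofConv) (id_mul_antipode_eq_one (k := k) (A := A))
  rw [Points.map_mul, Points.map_one] at h
  exact h

theorem Points.push_inverse (π : B →ₐc[k] A) (x : Points k A R) :
    x.inverse.push π = (x.push π).inverse := by
  refine left_inv_eq_right_inv (a := x.push π) ?_ (Points.mul_inverse _)
  rw [← Points.push_mul, Points.inverse_mul, Points.push_one]

theorem antipode_comorphism (π : B →ₐc[k] A) (b : B) :
    HopfAlgebra.antipode k (π b) = π (HopfAlgebra.antipode k b) :=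
  DFunLike.congr_fun (congrArg WithConv.ofConv
    (Points.push_inverse π (WithConv.toConv (AlgHom.id k A)))) b

end Points

/-- A closed subgroup scheme of the group scheme with coordinate ring `A`, given by the Hopf ideal
that defines it. -/
@[ext]
structure ClosedSubgroup (k A : Type u) [Field k] [CommRing A] [HopfAlgebra k A] where
  /-- the defining ideal -/
  ideal : Ideal A
  isHopfIdeal : ideal.IsHopfIdeal k

namespace ClosedSubgroup

variable {k A B : Type u} [Field k] [CommRing A] [HopfAlgebra k A] [CommRing B] [HopfAlgebra k B]

/-- `H(R) ⊆ G(R)`. -/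
def points (H : ClosedSubgroup k A) (R : Type u) [CommRing R] [Algebra k R] :
    Set (Points k A R) :=
  {x | ∀ a ∈ H.ideal, x.ofConv a = 0}

/-- Inclusion of closed subgroup schemes reverses the inclusion of ideals. -/
instance : LE (ClosedSubgroup k A) := ⟨fun H K => K.ideal ≤ H.ideal⟩

/-- `H` is smooth over `k`. -/
def IsSmooth (H : ClosedSubgroup k A) : Prop := Algebra.Smooth k (A ⧸ H.ideal)

/-- `H` is a finite `k`-group scheme. -/
def IsFinite (H : ClosedSubgroup k A) : Prop := Module.Finite k (A ⧸ H.ideal)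

/-- A closed subscheme whose `R`-points form a subgroup of `G(R)` for all `R` is a closed subgroup
scheme. -/
def ofPoints (I : Ideal A)
    (one_mem : ∀ a ∈ I, (1 : Points k A k).ofConv a = 0)
    (mul_mem : ∀ (R : Type u) [CommRing R] [Algebra k R] (x y : Points k A R),
      (∀ a ∈ I, x.ofConv a = 0) → (∀ a ∈ I, y.ofConv a = 0) → ∀ a ∈ I, (x * y).ofConv a = 0)
    (inv_mem : ∀ (R : Type u) [CommRing R] [Algebra k R] (x : Points k A R),
      (∀ a ∈ I, x.ofConv a = 0) → ∀ a ∈ I, x.inverse.ofConv a = 0) :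
    ClosedSubgroup k A where
  ideal := I
  isHopfIdeal :=
    { counit_eq_zero := fun a ha => one_mem a ha
      map_mkQ_comul_eq_zero := fun a ha => by
        let q := Ideal.Quotient.mkₐ k I
        have hq : ∀ a ∈ I, q a = 0 := fun a ha => Ideal.Quotient.eq_zero_iff_mem.mpr ha
        have h := mul_mem ((A ⧸ I) ⊗[k] (A ⧸ I))
          (WithConv.toConv (Algebra.TensorProduct.includeLeft.comp q))
          (WithConv.toConv (Algebra.TensorProduct.includeRight.comp q))
          (fun a ha => by simp [hq a ha]) (fun a ha => by simp [hq a ha]) a ha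
        rw [AlgHom.convMul_apply] at h
        have e : Algebra.TensorProduct.lift
            (Algebra.TensorProduct.includeLeft.comp q :
              A →ₐ[k] (A ⧸ I) ⊗[k] (A ⧸ I))
            (Algebra.TensorProduct.includeRight.comp q) (fun _ _ => Commute.all _ _) =
            Algebra.TensorProduct.map q q := by ext <;> simp
        simp only [e] at h
        exact h
      antipode_mem := fun a ha => by
        have h := inv_mem (A ⧸ I) (WithConv.toConv (Ideal.Quotient.mkₐ k I))
          (fun a ha => Ideal.Quotient.eq_zero_iff_mem.mpr ha) a ha
        exact Ideal.Quotient.eq_zero_iff_mem.mp h }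

theorem one_mem_points (H : ClosedSubgroup k A) (R : Type u) [CommRing R] [Algebra k R] :
    (1 : Points k A R) ∈ H.points R := fun a ha => by
  change algebraMap k R (Coalgebra.counit a) = 0
  rw [H.isHopfIdeal.counit_eq_zero ha, map_zero]

theorem mul_mem_points (H : ClosedSubgroup k A) {R : Type u} [CommRing R] [Algebra k R]
    {x y : Points k A R} (hx : x ∈ H.points R) (hy : y ∈ H.points R) : x * y ∈ H.points R :=
  fun a ha => by
  rw [AlgHom.convMul_apply]
  have h : Algebra.TensorProduct.map (Ideal.Quotient.mkₐ k H.ideal) (Ideal.Quotient.mkₐ k H.ideal)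
    (Coalgebra.comul a) = 0 := H.isHopfIdeal.map_mkQ_comul_eq_zero ha
  have e : Algebra.TensorProduct.lift x.ofConv y.ofConv (fun _ _ => Commute.all _ _) =
      (Algebra.TensorProduct.lift (Ideal.Quotient.liftₐ H.ideal x.ofConv hx)
        (Ideal.Quotient.liftₐ H.ideal y.ofConv hy) (fun _ _ => Commute.all _ _)).comp
      (Algebra.TensorProduct.map (Ideal.Quotient.mkₐ k H.ideal)
        (Ideal.Quotient.mkₐ k H.ideal)) := by
    ext a
    · simp
      exact (Ideal.Quotient.lift_mk H.ideal (x.ofConv : A →+* R) hx).symm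
    · simp
      exact (Ideal.Quotient.lift_mk H.ideal (y.ofConv : A →+* R) hy).symm
  rw [e, AlgHom.comp_apply, h, map_zero]

theorem inverse_mem_points (H : ClosedSubgroup k A) {R : Type u} [CommRing R] [Algebra k R]
    {x : Points k A R} (hx : x ∈ H.points R) : x.inverse ∈ H.points R :=
  fun _ ha => hx _ (H.isHopfIdeal.antipode_mem ha)

/-- `G` as a closed subgroup scheme of itself. -/
def whole (k A : Type u) [Field k] [CommRing A] [HopfAlgebra k A] : ClosedSubgroup k A :=
  ofPoints ⊥ (fun a ha => by rw [Ideal.mem_bot.mp ha, map_zero])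
    (fun R _ _ x y _ _ a ha => by rw [Ideal.mem_bot.mp ha, map_zero])
    (fun R _ _ x _ a ha => by rw [Ideal.mem_bot.mp ha, map_zero])

/-- The trivial closed subgroup scheme `{e}`, defined by the kernel of the counit. -/
noncomputable def trivial (k A : Type u) [Field k] [CommRing A] [HopfAlgebra k A] :
    ClosedSubgroup k A :=
  have key : ∀ (R : Type u) [CommRing R] [Algebra k R] (x : Points k A R),
      (∀ a ∈ RingHom.ker (Bialgebra.counitAlgHom k A), x.ofConv a = 0) → x = 1 := by
    intro R _ _ x hx
    apply WithConv.ofConv_injective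
    ext a
    have h := hx (a - algebraMap k A (Coalgebra.counit a)) (by simp [RingHom.mem_ker])
    rw [map_sub, AlgHom.commutes, sub_eq_zero] at h
    exact h
  have key' : ∀ (R : Type u) [CommRing R] [Algebra k R],
      ∀ a ∈ RingHom.ker (Bialgebra.counitAlgHom k A), (1 : Points k A R).ofConv a = 0 := by
    intro R _ _ a ha
    change algebraMap k R (Bialgebra.counitAlgHom k A a) = 0
    rw [RingHom.mem_ker.mp ha, map_zero]
  ofPoints (RingHom.ker (Bialgebra.counitAlgHom k A)) (key' k)
    (fun R _ _ x y hx hy => by rw [key R x hx, key R y hy, one_mul]; exact key' R)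
    (fun R _ _ x hx => by
      have h := Points.inverse_mul x
      rw [key R x hx, mul_one] at h
      rw [key R x hx, h]; exact key' R)

theorem mem_map_ideal_iff (π : B →ₐc[k] A) (I : Ideal B) {R : Type u} [CommRing R] [Algebra k R]
    (x : Points k A R) :
    (∀ a ∈ I.map (π : B →ₐ[k] A), x.ofConv a = 0) ↔ ∀ b ∈ I, (x.push π).ofConv b = 0 := by
  constructor
  · intro h b hb
    exact h _ (Ideal.mem_map_of_mem _ hb)
  · intro h
    have : I.map (π : B →ₐ[k] A) ≤ RingHom.ker x.ofConv :=
      Ideal.map_le_iff_le_comap.mpr fun b hb => RingHom.mem_ker.mpr (h b hb)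
    exact fun a ha => RingHom.mem_ker.mp (this ha)

/-- The preimage `π⁻¹ H'` under the morphism of group schemes with comorphism `π`: its ideal is
generated by the image of the ideal of `H'`. -/
def preimage (π : B →ₐc[k] A) (H' : ClosedSubgroup k B) : ClosedSubgroup k A :=
  ofPoints (H'.ideal.map (π : B →ₐ[k] A))
    ((mem_map_ideal_iff π _ _).mpr (by rw [Points.push_one]; exact H'.one_mem_points k))
    (fun R _ _ x y hx hy => (mem_map_ideal_iff π _ _).mpr (by
      rw [Points.push_mul]
      exact H'.mul_mem_points ((mem_map_ideal_iff π _ _).mp hx) ((mem_map_ideal_iff π _ _).mp hy)))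
    (fun R _ _ x hx => (mem_map_ideal_iff π _ _).mpr (by
      rw [Points.push_inverse]
      exact H'.inverse_mem_points ((mem_map_ideal_iff π _ _).mp hx)))

/-- The preimage has the expected points: `(π⁻¹ H')(R) = π(R)⁻¹(H'(R))`. -/
theorem mem_points_preimage (π : B →ₐc[k] A) (H' : ClosedSubgroup k B) {R : Type u} [CommRing R]
    [Algebra k R] (x : Points k A R) :
    x ∈ (preimage π H').points R ↔ x.push π ∈ H'.points R :=
  mem_map_ideal_iff π _ _

/-- The image `π H` under the morphism of group schemes with comorphism `π`: its ideal is the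
preimage under `π` of the ideal of `H`. -/
def image (π : B →ₐc[k] A) (H : ClosedSubgroup k A) : ClosedSubgroup k B where
  ideal := H.ideal.comap (π : B →ₐ[k] A)
  isHopfIdeal :=
    { counit_eq_zero := fun b hb => by
        have h := H.isHopfIdeal.counit_eq_zero (show π b ∈ H.ideal from hb)
        simpa using h
      map_mkQ_comul_eq_zero := fun b hb => by
        let J : Ideal B := H.ideal.comap (π : B →ₐ[k] A)
        let φ : (B ⧸ J) →ₐ[k] (A ⧸ H.ideal) :=
          Ideal.quotientMapₐ H.ideal (π : B →ₐ[k] A) le_rfl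
        have hφ : Function.Injective φ := Ideal.quotientMap_injective
        have hφφ : Function.Injective (Algebra.TensorProduct.map φ φ) :=
          TensorProduct.map_injective_of_flat_flat φ.toLinearMap φ.toLinearMap hφ hφ
        have h : Algebra.TensorProduct.map (Ideal.Quotient.mkₐ k H.ideal)
            (Ideal.Quotient.mkₐ k H.ideal) (Coalgebra.comul (π b)) = 0 :=
          H.isHopfIdeal.map_mkQ_comul_eq_zero (show π b ∈ H.ideal from hb)
        have hΔ : Coalgebra.comul (π b) = Algebra.TensorProduct.map (π : B →ₐ[k] A)
            (π : B →ₐ[k] A) (Coalgebra.comul b) :=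
          (CoalgHomClass.map_comp_comul_apply π b).symm
        have e : (Algebra.TensorProduct.map (Ideal.Quotient.mkₐ k H.ideal)
            (Ideal.Quotient.mkₐ k H.ideal)).comp
              (Algebra.TensorProduct.map (π : B →ₐ[k] A) (π : B →ₐ[k] A)) =
            (Algebra.TensorProduct.map φ φ).comp (Algebra.TensorProduct.map
              (Ideal.Quotient.mkₐ k J) (Ideal.Quotient.mkₐ k J)) := by
          ext <;> simp [φ, J]
        rw [hΔ, ← AlgHom.comp_apply, e, AlgHom.comp_apply] at h
        exact hφφ (h.trans (map_zero _).symm)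
      antipode_mem := fun b hb => by
        have h := H.isHopfIdeal.antipode_mem (show π b ∈ H.ideal from hb)
        rw [antipode_comorphism] at h
        exact h }

/-- The kernel of the morphism of group schemes with comorphism `π`. -/
noncomputable def kernel (π : B →ₐc[k] A) : ClosedSubgroup k A := preimage π (trivial k B)

/-- The `R`-points of the centralizer `C_G(H)`: the `g ∈ G(R)` such that `g_r` commutes with all
`h ∈ H(R')`, for every homomorphism `r : R → R'` of `k`-algebras. -/
def centralizerPoints (H : ClosedSubgroup k A) (R : Type u) [CommRing R] [Algebra k R] :
    Set (Points k A R) :=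
  {g | ∀ (R' : Type u) [CommRing R'] [Algebra k R'] (r : R →ₐ[k] R'),
    ∀ h ∈ H.points R', g.map r * h = h * g.map r}

/-- The comorphism of `G × H → G`, `(g, h) ↦ g h`. -/
noncomputable def mulLeft (H : ClosedSubgroup k A) : A →ₐ[k] A ⊗[k] (A ⧸ H.ideal) :=
  (Algebra.TensorProduct.map (AlgHom.id k A) (Ideal.Quotient.mkₐ k H.ideal)).comp
    (Bialgebra.comulAlgHom k A)

/-- The comorphism of `G × H → G`, `(g, h) ↦ h g`. -/
noncomputable def mulRight (H : ClosedSubgroup k A) : A →ₐ[k] A ⊗[k] (A ⧸ H.ideal) :=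
  ((Algebra.TensorProduct.comm k (A ⧸ H.ideal) A).toAlgHom.comp
    (Algebra.TensorProduct.map (Ideal.Quotient.mkₐ k H.ideal) (AlgHom.id k A))).comp
    (Bialgebra.comulAlgHom k A)

/-- The ideal of the centralizer of `H`: it is generated by the coefficients in `k[G]` of the
elements `mulLeft a - mulRight a` of `k[G] ⊗ k[H]`, `a ∈ k[G]`. -/
noncomputable def centralizerIdeal (H : ClosedSubgroup k A) : Ideal A :=
  Ideal.span {x | ∃ (a : A) (f : Module.Dual k (A ⧸ H.ideal)),
    x = TensorProduct.rid k A (f.lTensor A (H.mulLeft a - H.mulRight a))}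

theorem mul_eq_mulLeft (H : ClosedSubgroup k A) {R R' : Type u} [CommRing R] [Algebra k R]
    [CommRing R'] [Algebra k R'] (g : Points k A R) (r : R →ₐ[k] R')
    (h : (A ⧸ H.ideal) →ₐ[k] R') :
    (g.map r * WithConv.toConv (h.comp (Ideal.Quotient.mkₐ k H.ideal))).ofConv =
      (Algebra.TensorProduct.lift r h (fun _ _ => Commute.all _ _)).comp
        ((Algebra.TensorProduct.map g.ofConv (AlgHom.id k (A ⧸ H.ideal))).comp H.mulLeft) := by
  rw [AlgHom.convMul_def, mulLeft, ← AlgHom.comp_assoc, ← AlgHom.comp_assoc, ← AlgHom.comp_assoc]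
  refine congrArg (fun F : A ⊗[k] A →ₐ[k] R' => F.comp (Bialgebra.comulAlgHom k A)) ?_
  ext <;> simp [Points.map]

theorem mul_eq_mulRight (H : ClosedSubgroup k A) {R R' : Type u} [CommRing R] [Algebra k R]
    [CommRing R'] [Algebra k R'] (g : Points k A R) (r : R →ₐ[k] R')
    (h : (A ⧸ H.ideal) →ₐ[k] R') :
    (WithConv.toConv (h.comp (Ideal.Quotient.mkₐ k H.ideal)) * g.map r).ofConv =
      (Algebra.TensorProduct.lift r h (fun _ _ => Commute.all _ _)).comp
        ((Algebra.TensorProduct.map g.ofConv (AlgHom.id k (A ⧸ H.ideal))).comp H.mulRight) := by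
  rw [AlgHom.convMul_def, mulRight, ← AlgHom.comp_assoc, ← AlgHom.comp_assoc, ← AlgHom.comp_assoc]
  refine congrArg (fun F : A ⊗[k] A →ₐ[k] R' => F.comp (Bialgebra.comulAlgHom k A)) ?_
  ext <;> simp [Points.map]

theorem mem_centralizerPoints_iff_eq (H : ClosedSubgroup k A) {R : Type u} [CommRing R]
    [Algebra k R] (g : Points k A R) :
    g ∈ H.centralizerPoints R ↔
      ∀ a, Algebra.TensorProduct.map g.ofConv (AlgHom.id k (A ⧸ H.ideal))
        (H.mulLeft a - H.mulRight a) = 0 := by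
  constructor
  · intro hg a
    have h := hg (R ⊗[k] (A ⧸ H.ideal)) Algebra.TensorProduct.includeLeft
      (WithConv.toConv (Algebra.TensorProduct.includeRight.comp (Ideal.Quotient.mkₐ k H.ideal)))
      (fun a ha => by
        have : Ideal.Quotient.mkₐ k H.ideal a = 0 := Ideal.Quotient.eq_zero_iff_mem.mpr ha
        simp only [AlgHom.comp_apply, this, map_zero])
    have h' := congrArg WithConv.ofConv h
    rw [mul_eq_mulLeft, mul_eq_mulRight] at h'
    have e : Algebra.TensorProduct.lift
        (Algebra.TensorProduct.includeLeft : R →ₐ[k] R ⊗[k] (A ⧸ H.ideal))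
        Algebra.TensorProduct.includeRight (fun _ _ => Commute.all _ _) = AlgHom.id k _ := by
      ext <;> simp
    rw [e, AlgHom.id_comp, AlgHom.id_comp] at h'
    rw [map_sub, sub_eq_zero]
    exact DFunLike.congr_fun h' a
  · intro hg R' _ _ r h hh
    have e : h = WithConv.toConv ((Ideal.Quotient.liftₐ H.ideal h.ofConv hh).comp
        (Ideal.Quotient.mkₐ k H.ideal)) := by
      apply WithConv.ofConv_injective
      ext a
      exact (Ideal.Quotient.lift_mk H.ideal (h.ofConv : A →+* R') hh).symm
    rw [e]
    apply WithConv.ofConv_injective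
    rw [mul_eq_mulLeft, mul_eq_mulRight]
    ext a
    have h' := hg a
    rw [map_sub, sub_eq_zero] at h'
    simp only [AlgHom.comp_apply, h']

/-- The centralizer functor is represented by the closed subscheme with ideal
`centralizerIdeal`. -/
theorem mem_centralizerPoints_iff (H : ClosedSubgroup k A) {R : Type u} [CommRing R]
    [Algebra k R] (g : Points k A R) :
    (∀ a ∈ H.centralizerIdeal, g.ofConv a = 0) ↔ g ∈ H.centralizerPoints R := by
  have comm : ∀ (f : Module.Dual k (A ⧸ H.ideal)) (z : A ⊗[k] (A ⧸ H.ideal)),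
      g.ofConv (TensorProduct.rid k A (f.lTensor A z)) =
        TensorProduct.rid k R (f.lTensor R
          (Algebra.TensorProduct.map g.ofConv (AlgHom.id k (A ⧸ H.ideal)) z)) := by
    intro f z
    induction z with
    | zero => simp
    | tmul x y => simp
    | add x y hx hy => simp only [map_add, hx, hy]
  have sep : ∀ w : R ⊗[k] (A ⧸ H.ideal),
      (∀ f : Module.Dual k (A ⧸ H.ideal), TensorProduct.rid k R (f.lTensor R w) = 0) → w = 0 := by
    intro w hw
    classical
    let b := Module.Basis.ofVectorSpace k (A ⧸ H.ideal)
    apply (TensorProduct.equivFinsuppOfBasisRight (M := R) b).injective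
    ext i
    rw [map_zero, Finsupp.zero_apply, ← hw (b.coord i)]
    clear hw
    induction w with
    | zero => simp
    | tmul x y => simp
    | add x y hx hy => simp only [map_add, Finsupp.add_apply, hx, hy]
  rw [mem_centralizerPoints_iff_eq]
  constructor
  · intro h a
    apply sep
    intro f
    rw [← comm]
    exact h _ (Ideal.subset_span ⟨a, f, rfl⟩)
  · intro h
    have : H.centralizerIdeal ≤ RingHom.ker g.ofConv := by
      refine Ideal.span_le.mpr ?_
      rintro _ ⟨a, f, rfl⟩
      simp only [SetLike.mem_coe, RingHom.mem_ker]
      rw [comm, h a, map_zero, map_zero]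
    exact fun a ha => RingHom.mem_ker.mp (this ha)

/-- The centralizer `C_G(H)` of a closed subgroup scheme `H` of `G`. -/
noncomputable def centralizer (H : ClosedSubgroup k A) : ClosedSubgroup k A :=
  ofPoints H.centralizerIdeal
    ((mem_centralizerPoints_iff H _).mpr fun R' _ _ r h _ => by
      rw [Points.map_one, one_mul, mul_one])
    (fun R _ _ x y hx hy => (mem_centralizerPoints_iff H _).mpr fun R' _ _ r h hh => by
      have hx' := (mem_centralizerPoints_iff H _).mp hx R' r h hh
      have hy' := (mem_centralizerPoints_iff H _).mp hy R' r h hh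
      rw [Points.map_mul, mul_assoc, hy', ← mul_assoc, hx', mul_assoc])
    (fun R _ _ x hx => (mem_centralizerPoints_iff H _).mpr fun R' _ _ r h hh => by
      have hx' := (mem_centralizerPoints_iff H _).mp hx R' r h hh
      have h1 : x.inverse.map r * x.map r = 1 := by
        rw [← Points.map_mul, Points.inverse_mul, Points.map_one]
      have h2 : x.map r * x.inverse.map r = 1 := by
        rw [← Points.map_mul, Points.mul_inverse, Points.map_one]
      calc x.inverse.map r * h = x.inverse.map r * h * (x.map r * x.inverse.map r) := by
            rw [h2, mul_one]
        _ = x.inverse.map r * (x.map r * h) * x.inverse.map r := by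
            rw [hx']; simp only [mul_assoc]
        _ = h * x.inverse.map r := by rw [← mul_assoc, h1, one_mul])

/-- `C_G(H)` represents the centralizer functor. -/
theorem points_centralizer (H : ClosedSubgroup k A) (R : Type u) [CommRing R] [Algebra k R] :
    H.centralizer.points R = H.centralizerPoints R :=
  Set.ext fun g => mem_centralizerPoints_iff H g

/-- The center `Z(G) = C_G(G)`. -/
noncomputable def center (k A : Type u) [Field k] [CommRing A] [HopfAlgebra k A] :
    ClosedSubgroup k A :=
  (whole k A).centralizer

end ClosedSubgroup

section Isogeny

variable {k A B : Type u} [Field k] [CommRing A] [HopfAlgebra k A] [CommRing B] [HopfAlgebra k B]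

/-- The morphism of group schemes with comorphism `π : k[G'] → k[G]` is an isogeny: it is
surjective (its comorphism is injective) and has finite kernel. -/
structure IsIsogeny (π : B →ₐc[k] A) : Prop where
  injective : Function.Injective π
  finite_kernel : (ClosedSubgroup.kernel π).IsFinite

/-- The kernel is contained in the center. -/
def IsCentral (π : B →ₐc[k] A) : Prop :=
  ClosedSubgroup.kernel π ≤ ClosedSubgroup.center k A

/-- The kernel is smooth. -/
def IsSeparable (π : B →ₐc[k] A) : Prop :=
  (ClosedSubgroup.kernel π).IsSmooth

end Isogeny

end AffGrp

/-! Write C for `C_G(H)` and M for the preimage under π of `C_{G'}(πH)`. The proof compares C with M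
inside G, and M with `C_{G'}(πH)` along π. C is open and closed in M. If g lies in M and h in H, the
commutator of g and h lies in ker π. Over a square-zero thickening, if g centralizes H modulo the
square-zero ideal, then this commutator is a point of ker π that reduces to 1. Since ker π is finite
and smooth, its cotangent space at the identity is zero, so the commutator is 1. Hence the
first-order neighbourhood of C in M is C itself (`centralizer_ideal_le`), and the ideal of C in k[M]
is idempotent. Smoothness passes from M to the open subscheme C. It passes back because a group
scheme of finite type that is smooth on a nonempty open subscheme is smooth, by translations over
the algebraic closure (`isSmooth_iff_of_le_sq_sup`). The morphism π is faithfully flat because k[G']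
is reduced and embeds in k[G] (`faithfullyFlat_of_injective`). It is smooth because `G ×_{G'} G` is
isomorphic to `G × ker π` (`smooth_of_kernel_isSmooth`). So M is smooth over `C_{G'}(πH)`.
Conversely the coordinate ring of `C_{G'}(πH)` embeds in k[M], so geometric reducedness descends to
it, and for group schemes of finite type this implies smoothness. Faithful flatness rests on
homogeneity: an ideal of k[G'] stable under translation by G is 0 or everything
(`eq_bot_or_eq_top_of_stable`). It is applied to the ideal of b for which b·id has finite rank on a
finite equivariant module, and to the ideal of values at 1 of linear forms. Both are nonzero because
the local ring at a minimal prime is a field. The second claim follows from the first, since every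
H' is the image of its preimage. -/

namespace AffGrp

/-! ### The translation action of G on G', and stable ideals. -/

section Shear

variable {k A B : Type u} [Field k] [CommRing A] [HopfAlgebra k A] [CommRing B] [HopfAlgebra k B]

/-- The comorphism of `G' × G → G' × G`, `(x, g) ↦ (x π(g), g)`. -/
noncomputable def shear (π : B →ₐc[k] A) : B ⊗[k] A →ₐ[k] B ⊗[k] A :=
  Algebra.TensorProduct.lift
    ((Algebra.TensorProduct.map (AlgHom.id k B) (π : B →ₐ[k] A)).comp (Bialgebra.comulAlgHom k B))
    Algebra.TensorProduct.includeRight (fun _ _ => Commute.all _ _)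

/-- The comorphism of `G' × G → G' × G`, `(x, g) ↦ (x π(g)⁻¹, g)`. -/
noncomputable def shearInv (π : B →ₐc[k] A) : B ⊗[k] A →ₐ[k] B ⊗[k] A :=
  Algebra.TensorProduct.lift
    ((Algebra.TensorProduct.map (AlgHom.id k B)
      ((HopfAlgebra.antipodeAlgHom k A).comp (π : B →ₐ[k] A))).comp (Bialgebra.comulAlgHom k B))
    Algebra.TensorProduct.includeRight (fun _ _ => Commute.all _ _)

theorem shear_tmul_one (π : B →ₐc[k] A) (b : B) :
    shear π (b ⊗ₜ 1) = (π : B →ₐ[k] A).toLinearMap.lTensor B (Coalgebra.comul b) := by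
  simp only [shear, Algebra.TensorProduct.lift_tmul, map_one, mul_one]
  rfl

theorem shearInv_tmul_one (π : B →ₐc[k] A) (b : B) :
    shearInv π (b ⊗ₜ 1) = ((HopfAlgebra.antipodeAlgHom k A).comp
      (π : B →ₐ[k] A)).toLinearMap.lTensor B (Coalgebra.comul b) := by
  simp only [shearInv, Algebra.TensorProduct.lift_tmul, map_one, mul_one]
  rfl

theorem shear_one_tmul (π : B →ₐc[k] A) (a : A) : shear π (1 ⊗ₜ a) = 1 ⊗ₜ a := by
  simp [shear]

theorem shearInv_one_tmul (π : B →ₐc[k] A) (a : A) : shearInv π (1 ⊗ₜ a) = 1 ⊗ₜ a := by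
  simp [shearInv]

noncomputable instance {R : Type u} [CommRing R] [Algebra k R] : Inv (Points k A R) where
  inv := Points.inverse

noncomputable instance {R : Type u} [CommRing R] [Algebra k R] : Group (Points k A R) where
  inv_mul_cancel := Points.inverse_mul

theorem Points.map_inv {R R' : Type u} [CommRing R] [Algebra k R] [CommRing R'] [Algebra k R']
    (r : R →ₐ[k] R') (x : Points k A R) : (x⁻¹).map r = (x.map r)⁻¹ :=
  eq_inv_of_mul_eq_one_left (by rw [← Points.map_mul, inv_mul_cancel, Points.map_one])

theorem Points.mul_ofConv {R : Type u} [CommRing R] [Algebra k R] (x y : Points k A R) :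
    (x * y).ofConv = (Algebra.TensorProduct.lift x.ofConv y.ofConv
      (fun _ _ => Commute.all _ _)).comp (Bialgebra.comulAlgHom k A) := by
  ext a
  exact AlgHom.convMul_apply x y a

/-- On the universal points x of G' and y of G pushed to G', `shear` sends x to xy and fixes y,
while `shearInv` sends x to x y⁻¹. The identity is then cancellation in a group of points. -/
theorem shear_comp_shearInv (π : B →ₐc[k] A) :
    (shear π).comp (shearInv π) = AlgHom.id k (B ⊗[k] A) := by
  let x : Points k B (B ⊗[k] A) := WithConv.toConv Algebra.TensorProduct.includeLeft
  let y : Points k B (B ⊗[k] A) :=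
    WithConv.toConv (Algebra.TensorProduct.includeRight.comp (π : B →ₐ[k] A))
  have h1 : x.map (shear π) = x * y := by
    apply WithConv.ofConv_injective
    rw [Points.mul_ofConv]
    have e : Algebra.TensorProduct.lift x.ofConv y.ofConv (fun _ _ => Commute.all _ _) =
        Algebra.TensorProduct.map (AlgHom.id k B) (π : B →ₐ[k] A) := by
      ext <;> simp [x, y]
    rw [e]
    ext b
    simp [Points.map, x, shear]
  have h2 : y.map (shear π) = y := by
    apply WithConv.ofConv_injective
    ext b
    simp [Points.map, y, shear_one_tmul]
  have h3 : x.map (shearInv π) = x * y⁻¹ := by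
    apply WithConv.ofConv_injective
    rw [Points.mul_ofConv]
    have e : Algebra.TensorProduct.lift x.ofConv (y⁻¹).ofConv (fun _ _ => Commute.all _ _) =
        Algebra.TensorProduct.map (AlgHom.id k B)
          ((HopfAlgebra.antipodeAlgHom k A).comp (π : B →ₐ[k] A)) := by
      ext b
      · simp [x]
      · change _ = (1 : B) ⊗ₜ[k] HopfAlgebra.antipode k (π b)
        rw [antipode_comorphism]
        simp
        rfl
    rw [e]
    ext b
    simp [Points.map, x, shearInv]
  have h4 : x.map ((shear π).comp (shearInv π)) = x := by
    change (x.map (shearInv π)).map (shear π) = x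
    rw [h3, Points.map_mul, Points.map_inv, h1, h2, mul_inv_cancel_right]
  ext b
  · exact DFunLike.congr_fun (congrArg WithConv.ofConv h4) b
  · simp [shear_one_tmul, shearInv_one_tmul]

theorem shear_shearInv (π : B →ₐc[k] A) (z : B ⊗[k] A) : shear π (shearInv π z) = z :=
  DFunLike.congr_fun (shear_comp_shearInv π) z

theorem map_comp_shear (π : B →ₐc[k] A) :
    (Algebra.TensorProduct.map (π : B →ₐ[k] A) (AlgHom.id k A)).comp (shear π) =
      (shear (BialgHom.id k A)).comp
        (Algebra.TensorProduct.map (π : B →ₐ[k] A) (AlgHom.id k A)) := by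
  ext b
  · have hΔ : Coalgebra.comul (π b) = Algebra.TensorProduct.map (π : B →ₐ[k] A)
        (π : B →ₐ[k] A) (Coalgebra.comul b) :=
      (CoalgHomClass.map_comp_comul_apply π b).symm
    simp only [AlgHom.comp_apply, Algebra.TensorProduct.includeLeft_apply, shear,
      Algebra.TensorProduct.map_tmul, Algebra.TensorProduct.lift_tmul, map_one, mul_one,
      Bialgebra.comulAlgHom_apply]
    erw [hΔ]
    simp only [← AlgHom.comp_apply]
    refine DFunLike.congr_fun (F := B ⊗[k] B →ₐ[k] A ⊗[k] A) ?_ _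
    ext <;> simp
  · simp [shear_one_tmul]

theorem map_comp_shearInv (π : B →ₐc[k] A) :
    (Algebra.TensorProduct.map (π : B →ₐ[k] A) (AlgHom.id k A)).comp (shearInv π) =
      (shearInv (BialgHom.id k A)).comp
        (Algebra.TensorProduct.map (π : B →ₐ[k] A) (AlgHom.id k A)) := by
  ext b
  · have hΔ : Coalgebra.comul (π b) = Algebra.TensorProduct.map (π : B →ₐ[k] A)
        (π : B →ₐ[k] A) (Coalgebra.comul b) :=
      (CoalgHomClass.map_comp_comul_apply π b).symm
    simp only [AlgHom.comp_apply, Algebra.TensorProduct.includeLeft_apply, shearInv,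
      Algebra.TensorProduct.map_tmul, Algebra.TensorProduct.lift_tmul, map_one, mul_one,
      Bialgebra.comulAlgHom_apply]
    erw [hΔ]
    simp only [← AlgHom.comp_apply]
    refine DFunLike.congr_fun (F := B ⊗[k] B →ₐ[k] A ⊗[k] A) ?_ _
    ext <;> simp
  · simp [shearInv_one_tmul]

theorem map_shear_apply (π : B →ₐc[k] A) (w : B ⊗[k] A) :
    Algebra.TensorProduct.map (π : B →ₐ[k] A) (AlgHom.id k A) (shear π w) =
      shear (BialgHom.id k A)
        (Algebra.TensorProduct.map (π : B →ₐ[k] A) (AlgHom.id k A) w) :=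
  DFunLike.congr_fun (map_comp_shear π) w

theorem map_shearInv_apply (π : B →ₐc[k] A) (w : B ⊗[k] A) :
    Algebra.TensorProduct.map (π : B →ₐ[k] A) (AlgHom.id k A) (shearInv π w) =
      shearInv (BialgHom.id k A)
        (Algebra.TensorProduct.map (π : B →ₐ[k] A) (AlgHom.id k A) w) :=
  DFunLike.congr_fun (map_comp_shearInv π) w

/-- An ideal of `k[G']` that is stable under the coaction of `k[G]` is trivial. -/
theorem eq_bot_or_eq_top_of_stable (π : B →ₐc[k] A) (hπ : Function.Injective π) (I : Ideal B)
    (hI : ∀ b ∈ I, ∀ f : A →ₗ[k] k,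
      TensorProduct.rid k B (f.lTensor B (shear π (b ⊗ₜ 1))) ∈ I) : I = ⊥ ∨ I = ⊤ := by
  classical
  -- Since π has a k-linear left inverse, every form on k[G'] factors through π. Stability under
  -- k[G] thus gives stability under the comultiplication of k[G'].
  have hg : ∀ b ∈ I, ∀ g : B →ₗ[k] k,
      TensorProduct.rid k B (g.lTensor B (Coalgebra.comul b)) ∈ I := by
    intro b hb g
    obtain ⟨l, hl⟩ := LinearMap.exists_leftInverse_of_injective
      ((π : B →ₐ[k] A).toLinearMap) (LinearMap.ker_eq_bot.mpr hπ)
    have h := hI b hb (g ∘ₗ l)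
    rw [shear_tmul_one, ← LinearMap.comp_apply, ← LinearMap.lTensor_comp, LinearMap.comp_assoc,
      hl, LinearMap.comp_id] at h
    exact h
  let e := Module.Basis.ofVectorSpace k B
  have expand : ∀ z : B ⊗[k] B, z = ((TensorProduct.equivFinsuppOfBasisRight e) z).sum
      fun i c => c ⊗ₜ e i := by
    intro z
    conv_lhs => rw [← (TensorProduct.equivFinsuppOfBasisRight (M := B) e).symm_apply_apply z]
    rw [TensorProduct.equivFinsuppOfBasisRight_symm_apply]
  have coord : ∀ (z : B ⊗[k] B) i, (TensorProduct.equivFinsuppOfBasisRight e) z i =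
      TensorProduct.rid k B ((e.coord i).lTensor B z) := by
    intro z i
    induction z with
    | zero => simp
    | tmul x y => simp
    | add x y hx hy => simp only [map_add, Finsupp.add_apply, hx, hy]
  -- Uses ε(b) = Σ b₁ S(b₂) with all b₁ taken in I.
  have hε : ∀ b ∈ I, algebraMap k B (Coalgebra.counit b) ∈ I := by
    intro b hb
    have h := HopfAlgebra.mul_antipode_lTensor_comul_apply (R := k) b
    rw [← h]
    rw [expand (Coalgebra.comul b), map_finsuppSum, map_finsuppSum]
    refine Submodule.sum_mem _ fun i _ => ?_
    simp only [LinearMap.lTensor_tmul, LinearMap.mul'_apply, coord]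
    exact I.mul_mem_right _ (hg b hb _)
  -- If ε vanishes on I, then b = Σ ε(b₁) b₂ = 0. Otherwise I contains a nonzero scalar.
  by_cases hc : ∀ b ∈ I, (Coalgebra.counit b : k) = 0
  · left
    rw [eq_bot_iff]
    intro b hb
    have h := Coalgebra.rTensor_counit_comul (R := k) b
    rw [expand (Coalgebra.comul b), map_finsuppSum] at h
    have h0 : ∀ i ∈ (TensorProduct.equivFinsuppOfBasisRight e (Coalgebra.comul b)).support,
      (LinearMap.rTensor B (Coalgebra.counit (R := k)))
        ((TensorProduct.equivFinsuppOfBasisRight e (Coalgebra.comul b)) i ⊗ₜ e i) = 0 := by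
      intro i _
      rw [LinearMap.rTensor_tmul, coord, hc _ (hg b hb _), TensorProduct.zero_tmul]
    rw [Finsupp.sum, Finset.sum_eq_zero h0] at h
    have h' := congrArg (TensorProduct.lid k B) h
    simpa using h'.symm
  · right
    push Not at hc
    obtain ⟨b, hb, hb0⟩ := hc
    refine Ideal.eq_top_of_isUnit_mem _ (hε b hb) ?_
    exact (IsUnit.mk0 _ hb0).map (algebraMap k B)

end Shear
end AffGrp

namespace AffGrp

/-! ### Equivariant submodules of k[G], their linear forms and projectivity. -/

section Contract

variable {k A B : Type u} [Field k] [CommRing A] [HopfAlgebra k A] [CommRing B] [HopfAlgebra k B]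

/-- Contraction with a linear form on `k[G]`. -/
noncomputable def contract {X : Type u} [AddCommGroup X] [Module k X] [Module B X]
    [IsScalarTower k B X] (f : A →ₗ[k] k) : X ⊗[k] A →ₗ[B] X :=
  (TensorProduct.AlgebraTensorModule.rid k B X).toLinearMap ∘ₗ
    TensorProduct.AlgebraTensorModule.map LinearMap.id f

theorem contract_tmul {X : Type u} [AddCommGroup X] [Module k X] [Module B X]
    [IsScalarTower k B X] (f : A →ₗ[k] k) (x : X) (a : A) :
    contract (B := B) f (x ⊗ₜ[k] a) = f a • x := by
  simp [contract]

theorem contract_eq_rid (f : A →ₗ[k] k) (z : B ⊗[k] A) :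
    contract (B := B) f z = TensorProduct.rid k B (f.lTensor B z) := by
  induction z with
  | zero => simp
  | add x y hx hy => simp only [map_add, hx, hy]
  | tmul x y => simp [contract_tmul]

end Contract

section Costable

variable {k A B : Type u} [Field k] [CommRing A] [HopfAlgebra k A] [CommRing B] [HopfAlgebra k B]
  [Algebra B A] [IsScalarTower k B A]

/-- The inclusion of `M ⊗ k[G]` into `k[G] ⊗ k[G]`. -/
noncomputable def tensorIncl (M : Submodule B A) : M ⊗[k] A →ₗ[k] A ⊗[k] A :=
  (M.subtype.restrictScalars k).rTensor A

theorem tensorIncl_tmul (M : Submodule B A) (m : M) (a : A) :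
    tensorIncl (k := k) M (m ⊗ₜ a) = (m : A) ⊗ₜ a := rfl

theorem tensorIncl_injective (M : Submodule B A) : Function.Injective (tensorIncl (k := k) M) :=
  Module.Flat.rTensor_preserves_injective_linearMap _ M.injective_subtype

/-- The action of `k[G'] ⊗ k[G]` on `M ⊗ k[G]`. -/
noncomputable def tensorAct (k : Type u) [Field k] [HopfAlgebra k A] [HopfAlgebra k B]
    [IsScalarTower k B A] (M : Submodule B A) :
    B ⊗[k] A →ₗ[k] M ⊗[k] A →ₗ[k] M ⊗[k] A :=
  TensorProduct.map₂ (Algebra.lsmul k k M).toLinearMap (LinearMap.mul k A)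

/-- A `k[G']`-submodule of `k[G]` that is a subcomodule. -/
structure IsCostable (k : Type u) [Field k] [HopfAlgebra k A] [HopfAlgebra k B]
    [IsScalarTower k B A] (M : Submodule B A) : Prop where
  shear_mem : ∀ x ∈ M, shear (BialgHom.id k A) (x ⊗ₜ 1) ∈ (tensorIncl (k := k) M).range
  shearInv_mem : ∀ x ∈ M, shearInv (BialgHom.id k A) (x ⊗ₜ 1) ∈ (tensorIncl (k := k) M).range

/-- With the injectivity of `tensorIncl`, this lets identities in `M ⊗ k[G]` be checked by
multiplication in `k[G] ⊗ k[G]`. -/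
theorem tensorIncl_tensorAct (π : B →ₐc[k] A) (hπ : ∀ b, algebraMap B A b = π b)
    (M : Submodule B A) (w : B ⊗[k] A) (z : M ⊗[k] A) :
    tensorIncl M (tensorAct k M w z) =
      Algebra.TensorProduct.map (π : B →ₐ[k] A) (AlgHom.id k A) w * tensorIncl M z := by
  induction w with
  | zero => simp
  | add w₁ w₂ h₁ h₂ => simp only [map_add, LinearMap.add_apply, h₁, h₂, add_mul]
  | tmul b a =>
    induction z with
    | zero => simp
    | add z₁ z₂ h₁ h₂ => simp only [map_add, h₁, h₂, mul_add]
    | tmul m a' => simp [tensorAct, tensorIncl_tmul, Algebra.smul_def, hπ]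

theorem rTensor_tensorAct (M : Submodule B A) (s : M →ₗ[B] B) (w : B ⊗[k] A) (z : M ⊗[k] A) :
    (s.restrictScalars k).rTensor A (tensorAct k M w z) =
      w * (s.restrictScalars k).rTensor A z := by
  induction w with
  | zero => simp
  | add w₁ w₂ h₁ h₂ => simp only [map_add, LinearMap.add_apply, h₁, h₂, add_mul]
  | tmul b a =>
    induction z with
    | zero => simp
    | add z₁ z₂ h₁ h₂ => simp only [map_add, h₁, h₂, mul_add]
    | tmul m a' => simp [tensorAct]

/-- A linear form on a subcomodule, evaluated at all translates. -/
theorem exists_twist (π : B →ₐc[k] A) (hπ : ∀ b, algebraMap B A b = π b)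
    {M : Submodule B A} (hM : IsCostable k M) (s : M →ₗ[B] B) :
    ∃ τ : M →ₗ[B] B ⊗[k] A, ∀ (x : M) (z : M ⊗[k] A),
      tensorIncl M z = shearInv (BialgHom.id k A) ((x : A) ⊗ₜ 1) →
      τ x = shear π ((s.restrictScalars k).rTensor A z) := by
  choose c hc using fun x : M => hM.shearInv_mem x x.2
  have uniq : ∀ (x : M) (z : M ⊗[k] A),
      tensorIncl M z = shearInv (BialgHom.id k A) ((x : A) ⊗ₜ 1) → z = c x :=
    fun x z h => tensorIncl_injective M (h.trans (hc x).symm)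
  refine ⟨{ toFun := fun x => shear π ((s.restrictScalars k).rTensor A (c x)),
            map_add' := fun x y => ?_, map_smul' := fun b x => ?_ }, fun x z h => ?_⟩
  · rw [← uniq (x + y) (c x + c y) ?_, map_add, map_add]
    rw [map_add, hc, hc, ← map_add, ← TensorProduct.add_tmul]
    rfl
  -- Linearity over k[G']: translating the argument turns b into its inverse translate, and the
  -- outer `shear` undoes this.
  · rw [← uniq (b • x) (tensorAct k M (shearInv π (b ⊗ₜ 1)) (c x)) ?_, rTensor_tensorAct, map_mul,
      shear_shearInv, RingHom.id_apply, Algebra.smul_def]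
    · rfl
    · rw [tensorIncl_tensorAct π hπ, hc, map_shearInv_apply, ← map_mul]
      simp [Algebra.smul_def, hπ]
  · rw [uniq x z h]
    rfl

/-- The values at `1` of the linear forms on a subcomodule form the unit ideal. -/
theorem exists_apply_one_eq_one (π : B →ₐc[k] A) (hπ : ∀ b, algebraMap B A b = π b)
    (inj : Function.Injective π) {M : Submodule B A} (hM : IsCostable k M) (h1 : (1 : A) ∈ M)
    (s₀ : M →ₗ[B] B) (hs₀ : s₀ ⟨1, h1⟩ ≠ 0) : ∃ s : M →ₗ[B] B, s ⟨1, h1⟩ = 1 := by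
  let O : Ideal B := LinearMap.range (LinearMap.applyₗ (R := B) (M₂ := B) (⟨1, h1⟩ : M))
  have hO : O = ⊥ ∨ O = ⊤ := by
    refine eq_bot_or_eq_top_of_stable π inj O ?_
    rintro _ ⟨s, rfl⟩ f
    obtain ⟨τ, hτ⟩ := exists_twist π hπ hM s
    -- Since 1 is translation invariant, the twisted form sends 1 to `shear π (s 1 ⊗ 1)`; its
    -- contraction by f is again a value at 1.
    refine ⟨contract f ∘ₗ τ, ?_⟩
    rw [LinearMap.applyₗ_apply_apply, LinearMap.comp_apply,
      hτ ⟨1, h1⟩ (⟨1, h1⟩ ⊗ₜ 1) (by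
        rw [tensorIncl_tmul, ← Algebra.TensorProduct.one_def, map_one]), contract_eq_rid]
    rfl
  rcases hO with h | h
  · exact absurd ((Submodule.mem_bot B).mp (h ▸ ⟨s₀, rfl⟩ : s₀ ⟨1, h1⟩ ∈ (⊥ : Ideal B))) hs₀
  · obtain ⟨s, hs⟩ : (1 : B) ∈ O := h ▸ Submodule.mem_top
    exact ⟨s, hs⟩

/-- The b for which b·id_M has finite rank form a stable ideal: a relation b x = Σ sᵢ(x) yᵢ can be
translated by G, and then contracted. Being nonzero, the ideal contains 1, which is the dual basis
criterion. -/
theorem projective_of_isCostable (π : B →ₐc[k] A) (hπ : ∀ b, algebraMap B A b = π b)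
    (inj : Function.Injective π) {M : Submodule B A} (hM : IsCostable k M)
    (b₀ : B) (hb₀ : b₀ ≠ 0)
    (hb₀' : b₀ • (1 : Module.End B M) ∈ LinearMap.range (dualTensorHom B M M)) :
    Module.Projective B M := by
  let I : Ideal B := (LinearMap.range (dualTensorHom B M M)).comap
    (LinearMap.toSpanSingleton B (Module.End B M) 1)
  have hI : I = ⊥ ∨ I = ⊤ := by
    refine eq_bot_or_eq_top_of_stable π inj I fun b hb f => ?_
    obtain ⟨t, ht⟩ := hb
    obtain ⟨n, s, y, rfl⟩ : ∃ (n : ℕ) (s : Fin n → Module.Dual B M) (y : Fin n → M),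
        t = ∑ i, s i ⊗ₜ y i := by
      obtain ⟨n, s, y, h⟩ := TensorProduct.exists_sum_tmul_eq t
      exact ⟨n, s, y, h⟩
    choose τ hτ using fun i => exists_twist π hπ hM (s i)
    choose w hw using fun i => hM.shear_mem (y i) (y i).2
    choose c hc using fun x : M => hM.shearInv_mem x x.2
    -- a contraction of `τ` against an element of `M ⊗ k[G]` has finite rank
    have rank : ∀ (τ : M →ₗ[B] B ⊗[k] A) (w : M ⊗[k] A), ∃ φ ∈ LinearMap.range (dualTensorHom B M M),
        ∀ x, φ x = contract (B := B) f (tensorAct k M (τ x) w) := by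
      intro τ w
      induction w with
      | zero => exact ⟨0, Submodule.zero_mem _, by simp⟩
      | add w₁ w₂ h₁ h₂ =>
        obtain ⟨φ₁, m₁, h₁⟩ := h₁
        obtain ⟨φ₂, m₂, h₂⟩ := h₂
        exact ⟨φ₁ + φ₂, Submodule.add_mem _ m₁ m₂, fun x => by simp [h₁, h₂]⟩
      | tmul m a =>
        refine ⟨_, ⟨(contract (f ∘ₗ LinearMap.mulRight k a) ∘ₗ τ) ⊗ₜ m, rfl⟩, fun x => ?_⟩
        rw [dualTensorHom_apply, LinearMap.comp_apply]
        induction τ x with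
        | zero => simp
        | add u v hu hv => simp only [map_add, LinearMap.add_apply, add_smul, hu, hv]
        | tmul b' a' => simp [tensorAct, contract_tmul]
    choose φ hφ hφ' using fun i => rank (τ i) (w i)
    change TensorProduct.rid k B _ • (1 : Module.End B M) ∈ LinearMap.range (dualTensorHom B M M)
    rw [← contract_eq_rid]
    suffices h : contract (B := B) f (shear π (b ⊗ₜ 1)) • (1 : Module.End B M) = ∑ i, φ i by
      rw [h]; exact Submodule.sum_mem _ fun i _ => hφ i
    ext x
    have key : tensorIncl M (∑ i, tensorAct k M (τ i x) (w i)) =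
        tensorIncl M (tensorAct k M (shear π (b ⊗ₜ 1)) (x ⊗ₜ 1)) := by
      -- The relation b m = Σ sᵢ(m) yᵢ extended to `M ⊗ k[G]`. Applying `shear` to it at z = `c x`,
      -- which represents `shearInv (x ⊗ 1)`, gives the translated relation.
      have aux : ∀ z : M ⊗[k] A, ∑ i, Algebra.TensorProduct.map (π : B →ₐ[k] A) (AlgHom.id k A)
          (((s i).restrictScalars k).rTensor A z) * ((y i : A) ⊗ₜ 1) =
          (π b ⊗ₜ 1) * tensorIncl M z := by
        intro z
        induction z with
        | zero => simp
        | add u v hu hv =>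
          simp only [map_add, add_mul, Finset.sum_add_distrib, hu, hv, mul_add]
        | tmul m a =>
          have h := congrArg (Submodule.subtype M) (LinearMap.congr_fun ht m)
          simp [Algebra.smul_def, hπ] at h
          simp [tensorIncl_tmul, ← h, TensorProduct.sum_tmul]
      simp only [map_sum, tensorIncl_tensorAct π hπ, hw, hτ _ x (c x) (hc x), map_shear_apply,
        ← map_mul, tensorIncl_tmul]
      rw [← map_sum, aux, map_mul, hc, shear_shearInv]
      simp
    have key' := congrArg (contract (B := B) f) (tensorIncl_injective M key)
    rw [map_sum] at key'
    simp only [LinearMap.smul_apply, Module.End.one_apply, LinearMap.sum_apply, hφ', key']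
    refine congrArg _ ?_
    induction shear π (b ⊗ₜ 1) with
    | zero => simp
    | add u v hu hv => simp only [map_add, LinearMap.add_apply, add_smul, hu, hv]
    | tmul b' a' => simp [tensorAct, contract_tmul]
  apply Module.Projective.of_one_mem_range_dualTensorHom
  rcases hI with h | h
  · exact absurd ((Submodule.mem_bot B).mp (h ▸ hb₀' : b₀ ∈ (⊥ : Ideal B))) hb₀
  · have : (1 : B) ∈ I := h ▸ Submodule.mem_top
    simpa [I] using this

end Costable
end AffGrp

/-! ### Generic behaviour of finite modules over a reduced ring. -/

namespace AffGrp

/-- At a minimal prime the maximal ideal of the local ring is its nilradical, which is zero by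
reducedness. -/
theorem isField_localization_of_mem_minimalPrimes {B : Type*} [CommRing B] [IsReduced B]
    (p : Ideal B) [p.IsPrime] (hp : p ∈ minimalPrimes B) : IsField (Localization.AtPrime p) := by
  rw [IsLocalRing.isField_iff_maximalIdeal_eq, eq_bot_iff]
  rw [← Localization.AtPrime.map_eq_maximalIdeal,
    ← IsLocalization.AtPrime.radical_map_of_mem_minimalPrimes (Localization.AtPrime p) p
    (I := ⊥) hp, Ideal.map_bot]
  exact (nilradical_eq_zero (Localization.AtPrime p)).le

section Generic

variable {B M : Type*} [CommRing B] [IsReduced B] [Nontrivial B] [IsNoetherianRing B]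
  [AddCommGroup M] [Module B M] [Module.Finite B M]

theorem comp_mem_range_dualTensorHom {B M : Type*} [CommRing B] [AddCommGroup M] [Module B M]
    {n : ℕ} (s : M →ₗ[B] Fin n → B) (p : (Fin n → B) →ₗ[B] M) :
    p ∘ₗ s ∈ LinearMap.range (dualTensorHom B M M) := by
  refine ⟨∑ i, (LinearMap.proj i ∘ₗ s) ⊗ₜ p (Pi.single i 1), ?_⟩
  ext x
  simp only [map_sum, LinearMap.sum_apply, dualTensorHom_apply, LinearMap.comp_apply,
    LinearMap.proj_apply]
  conv_rhs => rw [pi_eq_sum_univ' (s x), map_sum]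
  simp

/-- Over a reduced noetherian ring, some nonzero multiple of the identity of a finite module has
finite rank. -/
theorem exists_smul_one_mem_range_dualTensorHom :
    ∃ b : B, b ≠ 0 ∧ b • (1 : Module.End B M) ∈ LinearMap.range (dualTensorHom B M M) := by
  obtain ⟨p, hp⟩ := Ideal.nonempty_minimalPrimes (bot_ne_top : (⊥ : Ideal B) ≠ ⊤)
  have : p.IsPrime := hp.1.1
  let : Field (Localization.AtPrime p) :=
    (isField_localization_of_mem_minimalPrimes p hp).toField
  obtain ⟨n, q, hq⟩ := Module.Finite.exists_fin' B M
  have : Module.FinitePresentation B M := Module.finitePresentation_of_finite B M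
  let S := p.primeCompl
  let f := LocalizedModule.mkLinearMap S M
  let g := LocalizedModule.mkLinearMap S (Fin n → B)
  -- Over the field B_p the surjection q splits. Clearing denominators costs t to lift the section
  -- to M, and v to make q ∘ s = t hold before localizing.
  obtain ⟨σ, hσ⟩ := LinearMap.exists_rightInverse_of_surjective (LocalizedModule.map S q)
    (LinearMap.range_eq_top.mpr (LocalizedModule.map_surjective S q hq))
  obtain ⟨s, t, hs⟩ := Module.FinitePresentation.exists_lift_of_isLocalizedModule S g
    ((σ.restrictScalars B) ∘ₗ f)
  obtain ⟨v, hv⟩ := Module.Finite.exists_smul_of_comp_eq_of_isLocalizedModule S f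
    (q ∘ₗ s) (t • LinearMap.id) (by
      ext x
      have h1 : f (q (s x)) = LocalizedModule.map S q (g (s x)) := by
        simp [f, g]
      have h2 := LinearMap.congr_fun hs x
      have h3 := LinearMap.congr_fun hσ (f x)
      simp only [LinearMap.comp_apply] at h2
      simp only [LinearMap.comp_apply, h1, h2, LinearMap.smul_apply, LinearMap.map_smul_of_tower]
      exact congrArg (t • ·) h3)
  refine ⟨v * t, fun h => (v * t).2 (by simp [h]), ?_⟩
  have h := comp_mem_range_dualTensorHom ((v : B) • s) q
  rw [LinearMap.comp_smul] at h
  convert! h using 1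
  exact (mul_smul _ _ _).trans hv.symm

/-- As x has zero annihilator, it survives in the vector space M_p at a minimal prime p. A
functional nonzero on it comes from M after clearing denominators. -/
theorem exists_linearForm_ne_zero (x : M) (hx : ∀ b : B, b • x = 0 → b = 0) :
    ∃ s : M →ₗ[B] B, s x ≠ 0 := by
  obtain ⟨p, hp⟩ := Ideal.nonempty_minimalPrimes (bot_ne_top : (⊥ : Ideal B) ≠ ⊤)
  have : p.IsPrime := hp.1.1
  let : Field (Localization.AtPrime p) :=
    (isField_localization_of_mem_minimalPrimes p hp).toField
  have : Module.FinitePresentation B M := Module.finitePresentation_of_finite B M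
  let S := p.primeCompl
  let f := LocalizedModule.mkLinearMap S M
  have hf : f x ≠ 0 := fun h => by
    obtain ⟨c, hc⟩ := (IsLocalizedModule.eq_zero_iff S f).mp h
    exact c.2 (by rw [hx _ hc]; exact p.zero_mem)
  obtain ⟨φ, hφ⟩ := Module.Projective.exists_dual_ne_zero (Localization.AtPrime p) hf
  obtain ⟨s, t, hs⟩ := Module.FinitePresentation.exists_lift_of_isLocalizedModule S
    (Algebra.linearMap B (Localization.AtPrime p)) ((φ.restrictScalars B) ∘ₗ f)
  refine ⟨s, fun h => ?_⟩
  have h' := LinearMap.congr_fun hs x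
  simp only [LinearMap.comp_apply, h, map_zero, LinearMap.smul_apply] at h'
  refine hφ ?_
  have h'' : (t : B) • φ (f x) = 0 := h'.symm
  rw [Algebra.smul_def] at h''
  exact (IsLocalization.map_units (Localization.AtPrime p) t).mul_right_eq_zero.mp h''
end Generic

/-! ### Local finiteness of k[G] and faithful flatness over k[G']. -/

section FaithfullyFlat

variable {k A B : Type u} [Field k] [CommRing A] [HopfAlgebra k A] [CommRing B] [HopfAlgebra k B]
  [Algebra B A] [IsScalarTower k B A]

theorem range_tensorIncl_mono {M N : Submodule B A} (h : M ≤ N) :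
    (tensorIncl (k := k) M).range ≤ (tensorIncl (k := k) N).range := by
  rintro _ ⟨z, rfl⟩
  refine ⟨((Submodule.inclusion h).restrictScalars k).rTensor A z, ?_⟩
  rw [tensorIncl, tensorIncl, ← LinearMap.comp_apply, ← LinearMap.rTensor_comp]
  rfl

theorem isCostable_sup {M N : Submodule B A} (hM : IsCostable k M) (hN : IsCostable k N) :
    IsCostable k (M ⊔ N) := by
  constructor <;> intro x hx <;> obtain ⟨y, hy, z, hz, rfl⟩ := Submodule.mem_sup.mp hx <;>
    rw [TensorProduct.add_tmul, map_add]
  · exact Submodule.add_mem _ (range_tensorIncl_mono le_sup_left (hM.shear_mem y hy))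
      (range_tensorIncl_mono le_sup_right (hN.shear_mem z hz))
  · exact Submodule.add_mem _ (range_tensorIncl_mono le_sup_left (hM.shearInv_mem y hy))
      (range_tensorIncl_mono le_sup_right (hN.shearInv_mem z hz))

/-- On V both shears have the form (id ⊗ g) ∘ Δ and so land in V ⊗ k[G]. They are multiplicative and
compatible with π, so the property extends to k[G']-combinations. -/
theorem isCostable_span (π : B →ₐc[k] A) (hπ : ∀ b, algebraMap B A b = π b) (V : Submodule k A)
    (hV : ∀ v ∈ V, Coalgebra.comul v ∈ LinearMap.range (V.subtype.rTensor A)) :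
    IsCostable k (Submodule.span B (V : Set A)) := by
  let M := Submodule.span B (V : Set A)
  have hj : ∀ (g : A →ₗ[k] A) (v : A), v ∈ V →
      g.lTensor A (Coalgebra.comul v) ∈ (tensorIncl (k := k) M).range := by
    intro g v hv
    obtain ⟨z, hz⟩ := hV v hv
    let i : V →ₗ[k] M :=
      { toFun := fun v => ⟨v, Submodule.subset_span v.2⟩
        map_add' := fun _ _ => rfl
        map_smul' := fun _ _ => rfl }
    refine ⟨TensorProduct.map i g z, ?_⟩
    rw [← hz]
    clear hz
    induction z with
    | zero => simp
    | add x y hx hy => simp only [map_add, hx, hy]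
    | tmul x y => rfl
  constructor
  · intro x hx
    induction hx using Submodule.span_induction with
    | mem v hv =>
      rw [shear_tmul_one]
      exact hj _ v hv
    | zero => simp
    | add x y _ _ hx hy =>
      rw [TensorProduct.add_tmul, map_add]
      exact Submodule.add_mem _ hx hy
    | smul b x _ hx =>
      obtain ⟨z, hz⟩ := hx
      refine ⟨tensorAct k M (shear π (b ⊗ₜ 1)) z, ?_⟩
      rw [tensorIncl_tensorAct π hπ, hz, map_shear_apply, ← map_mul]
      simp [Algebra.smul_def, hπ]
  · intro x hx
    induction hx using Submodule.span_induction with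
    | mem v hv =>
      rw [shearInv_tmul_one]
      exact hj _ v hv
    | zero => simp
    | add x y _ _ hx hy =>
      rw [TensorProduct.add_tmul, map_add]
      exact Submodule.add_mem _ hx hy
    | smul b x _ hx =>
      obtain ⟨z, hz⟩ := hx
      refine ⟨tensorAct k M (shearInv π (b ⊗ₜ 1)) z, ?_⟩
      rw [tensorIncl_tensorAct π hπ, hz, map_shearInv_apply, ← map_mul]
      simp [Algebra.smul_def, hπ]

/-- Every element of `k[G]` lies in a finite-dimensional subcomodule. -/
theorem exists_finite_subcomodule (k : Type u) {A : Type u} [Field k] [CommRing A]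
    [HopfAlgebra k A] (a : A) :
    ∃ V : Submodule k A, V.FG ∧ a ∈ V ∧
      ∀ v ∈ V, Coalgebra.comul v ∈ LinearMap.range (V.subtype.rTensor A) := by
  classical
  -- V is the space of left coefficients of Δ(a). It is finite-dimensional because Δ(a) is a finite
  -- sum, and it contains a as the value at the counit.
  let ev : Module.Dual k A →ₗ[k] A :=
    { toFun := fun f => TensorProduct.rid k A (f.lTensor A (Coalgebra.comul a))
      map_add' := fun f g => by simp [LinearMap.lTensor_add]
      map_smul' := fun c f => by simp [LinearMap.lTensor_smul] }
  let V := LinearMap.range ev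
  have hΔ : (Coalgebra.comul a : A ⊗[k] A) ∈ LinearMap.range (V.subtype.rTensor A) := by
    let e := Module.Basis.ofVectorSpace k A
    have coord : ∀ (z : A ⊗[k] A) i, (TensorProduct.equivFinsuppOfBasisRight e) z i =
        TensorProduct.rid k A ((e.coord i).lTensor A z) := by
      intro z i
      induction z with
      | zero => simp
      | tmul x y => simp
      | add x y hx hy => simp only [map_add, Finsupp.add_apply, hx, hy]
    rw [← (TensorProduct.equivFinsuppOfBasisRight (M := A) e).symm_apply_apply (Coalgebra.comul a),
      TensorProduct.equivFinsuppOfBasisRight_symm_apply]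
    refine Submodule.sum_mem _ fun i _ => ?_
    rw [coord]
    exact ⟨(⟨ev (e.coord i), e.coord i, rfl⟩ : V) ⊗ₜ e i, rfl⟩
  refine ⟨V, ?_, ⟨Coalgebra.counit, ?_⟩, ?_⟩
  · obtain ⟨V', hV', h⟩ := TensorProduct.exists_finite_submodule_left_of_setFinite
      {(Coalgebra.comul a : A ⊗[k] A)} (Set.finite_singleton _)
    obtain ⟨z, hz⟩ := h rfl
    have hle : V ≤ V' := by
      rintro _ ⟨f, rfl⟩
      change TensorProduct.rid k A (f.lTensor A (Coalgebra.comul a)) ∈ V'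
      rw [← hz]
      clear hz
      induction z with
      | zero => simp
      | add x y hx hy => simp only [map_add]; exact V'.add_mem hx hy
      | tmul x y => simpa using V'.smul_mem _ x.2
    rw [← Module.Finite.iff_fg]
    exact Submodule.finiteDimensional_of_le hle
  · simp [ev, Coalgebra.lTensor_counit_comul]
  · rintro _ ⟨f, rfl⟩
    obtain ⟨z, hz⟩ := hΔ
    let g : A →ₗ[k] A := (TensorProduct.rid k A).toLinearMap ∘ₗ f.lTensor A ∘ₗ Coalgebra.comul
    -- Coassociativity: g acts only on the right factor, so the left factors of Δ(`ev f`) stay in V.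
    have key : Coalgebra.comul (ev f) = g.lTensor A (Coalgebra.comul a) := by
      have h := Coalgebra.coassoc_apply (R := k) a
      have h1 : ∀ z : A ⊗[k] A,
          (TensorProduct.rid k (A ⊗[k] A)) (f.lTensor (A ⊗[k] A) (Coalgebra.comul.rTensor A z)) =
          Coalgebra.comul (TensorProduct.rid k A (f.lTensor A z)) := by
        intro z
        induction z with
        | zero => simp
        | add x y hx hy => simp only [map_add, hx, hy]
        | tmul x y => simp
      have h2 : ∀ w : A ⊗[k] (A ⊗[k] A),
          (TensorProduct.rid k (A ⊗[k] A)) (f.lTensor (A ⊗[k] A)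
            ((TensorProduct.assoc k A A A).symm w)) =
          ((TensorProduct.rid k A).toLinearMap ∘ₗ f.lTensor A).lTensor A w := by
        intro w
        induction w with
        | zero => simp
        | add x y hx hy => simp only [map_add, hx, hy]
        | tmul x y =>
          induction y with
          | zero => simp
          | add y y' hx hy => simp only [map_add, TensorProduct.tmul_add, hx, hy]
          | tmul y y' => simp
      have h3 := h2 (Coalgebra.comul.lTensor A (Coalgebra.comul a))
      rw [← h, LinearEquiv.symm_apply_apply, h1] at h3
      refine h3.trans ?_
      rw [h, ← LinearMap.comp_apply, ← LinearMap.lTensor_comp]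
      rfl
    rw [key, ← hz]
    refine ⟨g.lTensor V z, ?_⟩
    rw [← LinearMap.comp_apply, ← LinearMap.comp_apply, LinearMap.lTensor_comp_rTensor,
      LinearMap.rTensor_comp_lTensor]

theorem exists_isCostable_of_finset (π : B →ₐc[k] A) (hπ : ∀ b, algebraMap B A b = π b)
    (F : Finset A) : ∃ M : Submodule B A, M.FG ∧ IsCostable k M ∧ ∀ a ∈ F, a ∈ M := by
  classical
  induction F using Finset.induction_on with
  | empty =>
    refine ⟨⊥, Submodule.fg_bot, ⟨fun x hx => ?_, fun x hx => ?_⟩, by simp⟩ <;>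
      rw [(Submodule.mem_bot B).mp hx, TensorProduct.zero_tmul, map_zero] <;>
      exact Submodule.zero_mem _
  | insert a F _ ih =>
    obtain ⟨M, hM, hM', hF⟩ := ih
    obtain ⟨V, ⟨S, hS⟩, ha, hV⟩ := exists_finite_subcomodule k a
    refine ⟨M ⊔ Submodule.span B (V : Set A), hM.sup ⟨S, ?_⟩,
      isCostable_sup hM' (isCostable_span π hπ V hV), fun x hx => ?_⟩
    · rw [← hS]
      exact (Submodule.span_span_of_tower k B (S : Set A)).symm
    · rcases Finset.mem_insert.mp hx with rfl | hx
      · exact Submodule.mem_sup_right (Submodule.subset_span ha)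
      · exact Submodule.mem_sup_left (hF x hx)

theorem nontrivial_of_hopfAlgebra (k A : Type u) [Field k] [CommRing A] [HopfAlgebra k A] :
    Nontrivial A :=
  (Bialgebra.counitAlgHom k A).toRingHom.domain_nontrivial

/-- The coordinate ring of a group scheme is faithfully flat over that of a reduced quotient. -/
theorem faithfullyFlat_of_injective [IsReduced B] [IsNoetherianRing B] (π : B →ₐc[k] A)
    (hπ : ∀ b, algebraMap B A b = π b) (inj : Function.Injective π) :
    Module.FaithfullyFlat B A := by
  classical
  have := nontrivial_of_hopfAlgebra k B
  have flat : Module.Flat B A := by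
    -- Flatness by the equational criterion: a relation involves finitely many elements, hence lives
    -- in a finite equivariant M, which is projective.
    refine Module.Flat.of_forall_isTrivialRelation fun {l f x} h => ?_
    obtain ⟨M, hfg, hM, hx⟩ := exists_isCostable_of_finset π hπ (Finset.univ.image x)
    have : Module.Finite B M := Module.Finite.iff_fg.mpr hfg
    obtain ⟨b, hb, hb'⟩ := exists_smul_one_mem_range_dualTensorHom (B := B) (M := M)
    have := projective_of_isCostable π hπ inj hM b hb hb'
    let y : Fin l → M := fun i => ⟨x i, hx _ (by simp)⟩
    have hy : ∑ i, f i • y i = 0 := by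
      apply Subtype.ext
      simpa [y] using h
    obtain ⟨κ, a, z, h1, h2⟩ := Module.Flat.isTrivialRelation_of_sum_smul_eq_zero hy
    refine ⟨κ, a, fun j => z j, fun i => ?_, h2⟩
    have := congrArg (Submodule.subtype M) (h1 i)
    simpa [y] using this
  refine { flat with submodule_ne_top := fun m hm htop => ?_ }
  -- Membership of x in m k[G] uses finitely many elements F; once M contains F, every linear form
  -- on M sends x into m. For x = 1 this contradicts the existence of a form with value 1.
  have loc : ∀ x ∈ m • (⊤ : Submodule B A), ∃ F : Finset A, ∀ M : Submodule B A,
      (∀ a ∈ F, a ∈ M) → ∃ h : x ∈ M, ∀ s : M →ₗ[B] B, s ⟨x, h⟩ ∈ m := by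
    intro x hx
    induction hx using Submodule.smul_induction_on' with
    | smul r hr a _ =>
      refine ⟨{a}, fun M hM => ⟨M.smul_mem r (hM a (by simp)), fun s => ?_⟩⟩
      have : s ⟨r • a, M.smul_mem r (hM a (by simp))⟩ = r • s ⟨a, hM a (by simp)⟩ := by
        rw [← map_smul]; rfl
      rw [this]
      exact m.mul_mem_right _ hr
    | add x _ y _ hx hy =>
      obtain ⟨F, hF⟩ := hx
      obtain ⟨F', hF'⟩ := hy
      refine ⟨F ∪ F', fun M hM => ?_⟩
      obtain ⟨h, hs⟩ := hF M fun a ha => hM a (Finset.mem_union_left _ ha)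
      obtain ⟨h', hs'⟩ := hF' M fun a ha => hM a (Finset.mem_union_right _ ha)
      refine ⟨M.add_mem h h', fun s => ?_⟩
      have : s ⟨x + y, M.add_mem h h'⟩ = s ⟨x, h⟩ + s ⟨y, h'⟩ := by
        rw [← map_add]; rfl
      rw [this]
      exact m.add_mem (hs s) (hs' s)
  obtain ⟨F, hF⟩ := loc 1 (htop.ge Submodule.mem_top)
  obtain ⟨M, hfg, hM, hx⟩ := exists_isCostable_of_finset π hπ F
  obtain ⟨h1, hs⟩ := hF M hx
  have : Module.Finite B M := Module.Finite.iff_fg.mpr hfg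
  obtain ⟨s₀, hs₀⟩ := exists_linearForm_ne_zero (B := B) (⟨1, h1⟩ : M) fun b hb => inj (by
    have := congrArg (Submodule.subtype M) hb
    simpa [Algebra.smul_def, hπ] using this)
  obtain ⟨s, hs1⟩ := exists_apply_one_eq_one π hπ inj hM h1 s₀ hs₀
  exact hm.ne_top ((Ideal.eq_top_iff_one m).mpr (hs1 ▸ hs s))

end FaithfullyFlat
end AffGrp

namespace AffGrp

/-! ### Smooth algebras over a field are reduced. -/

section Reduced

/-- By flatness S embeds in its base change to the fraction field of the polynomial ring, which is
étale over a field. -/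
theorem isReduced_of_etale_mvPolynomial (k S : Type*) [Field k] [CommRing S] (n : ℕ)
    [Algebra (MvPolynomial (Fin n) k) S] [Algebra.Etale (MvPolynomial (Fin n) k) S] :
    IsReduced S := by
  let P := MvPolynomial (Fin n) k
  have : IsReduced (FractionRing P ⊗[P] S) :=
    Algebra.FormallyUnramified.isReduced_of_field (FractionRing P) (FractionRing P ⊗[P] S)
  exact isReduced_of_injective
    (Algebra.TensorProduct.includeRight : S →ₐ[P] FractionRing P ⊗[P] S)
    (Algebra.TensorProduct.includeRight_injective (IsFractionRing.injective P (FractionRing P)))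

/-- A smooth algebra over a field is reduced. -/
theorem isReduced_of_smooth (k S : Type*) [Field k] [CommRing S] [Algebra k S]
    [Algebra.Smooth k S] : IsReduced S := by
  refine ⟨fun x hx => ?_⟩
  by_contra hx0
  -- m contains the annihilator of x. A neighbourhood of m étale over affine space is reduced, so a
  -- power of some f outside m kills x.
  obtain ⟨m, hm, hle⟩ := Ideal.exists_le_maximal (LinearMap.ker (LinearMap.toSpanSingleton S S x))
    (fun h => hx0 (by simpa using (Ideal.eq_top_iff_one _).mp h))
  have hs : Algebra.IsSmoothAt k m :=
    (Algebra.smoothLocus_eq_univ (R := k) (A := S)).ge (Set.mem_univ ⟨m, hm.isPrime⟩)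
  obtain ⟨f, hf, n, _, _, _⟩ := Algebra.IsSmoothAt.exists_isStandardEtale_mvPolynomial
    (R := k) (p := m)
  have := isReduced_of_etale_mvPolynomial k (Localization.Away f) n
  have h0 := (hx.map (algebraMap S (Localization.Away f))).eq_zero
  obtain ⟨⟨_, i, rfl⟩, hc⟩ := (IsLocalization.map_eq_zero_iff (.powers f) _ _).mp h0
  exact hf (hm.isPrime.mem_of_pow_mem i (hle (by simpa using hc)))

end Reduced

/-! ### Translations, and smoothness from a smooth open part. -/

section Translation

variable {k A : Type u} [Field k] [CommRing A] [HopfAlgebra k A]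

/-- The comorphism of the left translation by a rational point. -/
noncomputable def translate (z : Points k A k) : A →ₐ[k] A :=
  (z.map (Algebra.ofId k A) * WithConv.toConv (AlgHom.id k A)).ofConv

theorem map_translate {R : Type u} [CommRing R] [Algebra k R] (x : Points k A R)
    (z : Points k A k) :
    x.ofConv.comp (translate z) = (z.map (Algebra.ofId k R) * x).ofConv := by
  have h := Points.map_mul x.ofConv (z.map (Algebra.ofId k A)) (WithConv.toConv (AlgHom.id k A))
  have h1 : (z.map (Algebra.ofId k A)).map x.ofConv = z.map (Algebra.ofId k R) := by
    apply WithConv.ofConv_injective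
    ext a
    simp [Points.map]
  rw [h1] at h
  exact congrArg WithConv.ofConv h

theorem translate_comp (y z : Points k A k) :
    (translate y).comp (translate z) = translate (z * y) := by
  have h := map_translate (WithConv.toConv (translate y)) z
  rw [WithConv.ofConv_toConv] at h
  rw [h, translate, translate, WithConv.toConv_ofConv, ← mul_assoc, ← Points.map_mul]

theorem translate_one : translate (1 : Points k A k) = AlgHom.id k A := by
  rw [translate, Points.map_one, one_mul]

/-- Left translation by a rational point. -/
noncomputable def translateEquiv (z : Points k A k) : A ≃ₐ[k] A :=
  AlgEquiv.ofAlgHom (translate z) (translate z⁻¹)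
    (by rw [translate_comp, inv_mul_cancel, translate_one])
    (by rw [translate_comp, mul_inv_cancel, translate_one])

theorem isSmoothAt_comap_algEquiv {A' : Type*} [CommRing A'] [Algebra k A'] (e : A ≃ₐ[k] A')
    (p : Ideal A') [p.IsPrime] (q : Ideal A) [q.IsPrime] (hq : q = p.comap e)
    (h : Algebra.IsSmoothAt k p) : Algebra.IsSmoothAt k q := by
  subst hq
  refine Algebra.FormallySmooth.of_equiv (A := Localization.AtPrime p)
    (IsLocalization.algEquivOfAlgEquiv (M := (p.comap e).primeCompl) (T := p.primeCompl)
      (Localization.AtPrime (p.comap e)) (Localization.AtPrime p) e ?_).symm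
  ext x
  constructor
  · rintro ⟨y, hy, rfl⟩
    exact hy
  · intro hx
    refine ⟨e.symm x, ?_, by simp⟩
    simpa [Ideal.primeCompl] using hx

theorem exists_point_of_isMaximal [IsAlgClosed k] [Algebra.FiniteType k A] (m : Ideal A)
    [m.IsMaximal] : ∃ x : Points k A k, RingHom.ker x.ofConv = m := by
  let := Ideal.Quotient.field m
  have : Module.Finite k (A ⧸ m) := finite_of_finite_type_of_isJacobsonRing k (A ⧸ m)
  let φ : (A ⧸ m) →ₐ[k] k := IsAlgClosed.lift
  refine ⟨WithConv.toConv (φ.comp (Ideal.Quotient.mkₐ k m)), ?_⟩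
  ext a
  rw [RingHom.mem_ker]
  change φ (Ideal.Quotient.mk m a) = 0 ↔ _
  rw [map_eq_zero_iff φ φ.toRingHom.injective, Ideal.Quotient.eq_zero_iff_mem]

/-- Over an algebraically closed field, a group scheme of finite type that is smooth at one point
is smooth. -/
theorem smooth_of_smoothLocus_nonempty [IsAlgClosed k] [Algebra.FiniteType k A]
    (h : (Algebra.smoothLocus k A).Nonempty) : Algebra.Smooth k A := by
  have : Algebra.FinitePresentation k A := Algebra.FinitePresentation.of_finiteType.mp inferInstance
  have : IsJacobsonRing A := isJacobsonRing_of_finiteType (A := k)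
  refine ⟨Algebra.smoothLocus_eq_univ_iff.mp ?_, inferInstance⟩
  by_contra hne
  -- By the Jacobson property, the smooth locus and its complement, if nonempty, both contain closed
  -- points. These are rational, and translation by y x⁻¹ carries one to the other.
  obtain ⟨p, hp, hpc⟩ := nonempty_inter_closedPoints h
    Algebra.isOpen_smoothLocus.isLocallyClosed
  obtain ⟨q, hq, hqc⟩ := nonempty_inter_closedPoints (Set.nonempty_compl.mpr hne)
    Algebra.isOpen_smoothLocus.isClosed_compl.isLocallyClosed
  have := (PrimeSpectrum.isClosed_singleton_iff_isMaximal p).mp hpc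
  have := (PrimeSpectrum.isClosed_singleton_iff_isMaximal q).mp hqc
  obtain ⟨x, hx⟩ := exists_point_of_isMaximal (k := k) p.asIdeal
  obtain ⟨y, hy⟩ := exists_point_of_isMaximal (k := k) q.asIdeal
  refine hq (isSmoothAt_comap_algEquiv (translateEquiv (y * x⁻¹)) p.asIdeal q.asIdeal ?_ hp)
  have key : x.ofConv.comp (translate (y * x⁻¹)) = y.ofConv := by
    rw [map_translate]
    congr 1
    have : (y * x⁻¹).map (Algebra.ofId k k) = y * x⁻¹ := by
      apply WithConv.ofConv_injective
      ext a
      simp [Points.map]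
    rw [this, inv_mul_cancel_right]
  rw [← hx, ← hy, ← key]
  ext a
  rfl

/-- The local ring at a minimal prime is a finitely generated field extension of a perfect field,
hence formally smooth; one smooth point suffices. -/
theorem smooth_of_isReduced [IsAlgClosed k] [Algebra.FiniteType k A] [IsReduced A] :
    Algebra.Smooth k A := by
  have := nontrivial_of_hopfAlgebra k A
  obtain ⟨p, hp⟩ := Ideal.nonempty_minimalPrimes (bot_ne_top : (⊥ : Ideal A) ≠ ⊤)
  have : p.IsPrime := hp.1.1
  refine smooth_of_smoothLocus_nonempty ⟨⟨p, this⟩, ?_⟩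
  let : Field (Localization.AtPrime p) :=
    (isField_localization_of_mem_minimalPrimes p hp).toField
  have : Algebra.EssFiniteType A (Localization.AtPrime p) := .of_isLocalization _ p.primeCompl
  have : Algebra.EssFiniteType k (Localization.AtPrime p) := .comp _ A _
  exact Algebra.FormallySmooth.of_perfectField

/-- A geometrically reduced group scheme of finite type over a field is smooth. -/
theorem smooth_of_isGeometricallyReduced [Algebra.FiniteType k A]
    [Algebra.IsGeometricallyReduced k A] : Algebra.Smooth k A := by
  have : Algebra.Smooth (AlgebraicClosure k) (AlgebraicClosure k ⊗[k] A) := smooth_of_isReduced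
  exact Algebra.Smooth.of_smooth_tensorProduct_of_faithfullyFlat (AlgebraicClosure k)

theorem isGeometricallyReduced_of_smooth (k S : Type*) [Field k] [CommRing S] [Algebra k S]
    [Algebra.Smooth k S] : Algebra.IsGeometricallyReduced k S := by
  rw [Algebra.isGeometricallyReduced_field_iff]
  exact isReduced_of_smooth (AlgebraicClosure k) _

/-- A group scheme of finite type over a field with a nonempty smooth basic open subscheme is
smooth. -/
theorem smooth_of_smooth_away [Algebra.FiniteType k A] (f : A) (hf : ¬ IsNilpotent f)
    [Algebra.Smooth k (Localization.Away f)] : Algebra.Smooth k A := by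
  let K := AlgebraicClosure k
  have : Algebra.FinitePresentation K (K ⊗[k] A) :=
    Algebra.FinitePresentation.of_finiteType.mp inferInstance
  have hsm : Algebra.Smooth K (Localization.Away ((1 : K) ⊗ₜ[k] f)) :=
    .of_equiv (IsLocalization.Away.tensorProductEquivTMulRight k K f (Localization.Away f))
  have hle := Algebra.basicOpen_subset_smoothLocus_iff_smooth.mpr hsm
  have : Algebra.Smooth K (K ⊗[k] A) := by
    refine smooth_of_smoothLocus_nonempty (Set.Nonempty.mono hle ?_)
    -- If the basic open set became empty over K, then 1 ⊗ f would be nilpotent, and so would f,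
    -- since k[G] embeds in its base change.
    by_contra hempty
    rw [Set.not_nonempty_iff_eq_empty] at hempty
    have h0 : IsNilpotent ((1 : K) ⊗ₜ[k] f) := by
      rw [← PrimeSpectrum.basicOpen_eq_bot_iff]
      exact TopologicalSpace.Opens.ext hempty
    refine hf ((IsNilpotent.map_iff (f := (Algebra.TensorProduct.includeRight :
      A →ₐ[k] K ⊗[k] A)) ?_).mp h0)
    exact Algebra.TensorProduct.includeRight_injective (algebraMap k K).injective
  exact Algebra.Smooth.of_smooth_tensorProduct_of_faithfullyFlat K

/-- A group scheme of finite type over a field with a nonempty smooth open and closed subscheme is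
smooth. -/
theorem smooth_of_smooth_quotient [Algebra.FiniteType k A] (I : Ideal A) (hI : IsIdempotentElem I)
    (hne : I ≠ ⊤) [Algebra.Smooth k (A ⧸ I)] : Algebra.Smooth k A := by
  have : IsNoetherianRing A := Algebra.FiniteType.isNoetherianRing k A
  -- A finitely generated idempotent ideal is generated by an idempotent e, so the quotient is the
  -- localization at 1 - e.
  obtain ⟨e, he, hIe⟩ := (Ideal.isIdempotentElem_iff_of_fg I (IsNoetherian.noetherian I)).mp hI
  have : IsLocalization.Away (1 - e) (A ⧸ I) :=
    IsLocalization.away_of_isIdempotentElem he.one_sub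
      (by simpa [Ideal.submodule_span_eq] using hIe) Ideal.Quotient.mk_surjective
  have : Algebra.Smooth k (Localization.Away (1 - e)) := .of_equiv
    ((IsLocalization.algEquiv (.powers (1 - e)) (A ⧸ I)
      (Localization.Away (1 - e))).restrictScalars k)
  refine smooth_of_smooth_away (1 - e) fun h => hne ?_
  have h0 : 1 - e = 0 := by
    obtain ⟨n, hn⟩ := h
    have := he.one_sub.pow_succ_eq n
    rw [← this, pow_succ, hn, zero_mul]
  rw [hIe, Ideal.eq_top_iff_one, sub_eq_zero.mp h0]
  exact Submodule.mem_span_singleton_self _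

end Translation
end AffGrp

namespace AffGrp

open AffGrp.ClosedSubgroup

/-! ### The torsor of π, and smoothness along preimages. -/

section Torsor

variable {k A B : Type u} [Field k] [CommRing A] [HopfAlgebra k A] [CommRing B] [HopfAlgebra k B]

theorem Points.push_inv {R : Type u} [CommRing R] [Algebra k R] (π : B →ₐc[k] A)
    (x : Points k A R) : (x⁻¹).push π = (x.push π)⁻¹ :=
  Points.push_inverse π x

theorem mem_points_trivial {R : Type u} [CommRing R] [Algebra k R] (x : Points k B R) :
    x ∈ (ClosedSubgroup.trivial k B).points R ↔ x = 1 := by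
  constructor
  · intro hx
    apply WithConv.ofConv_injective
    ext b
    have h := hx (b - algebraMap k B (Coalgebra.counit b))
      (show _ ∈ RingHom.ker (Bialgebra.counitAlgHom k B) by simp [RingHom.mem_ker])
    rw [map_sub, AlgHom.commutes, sub_eq_zero] at h
    exact h
  · rintro rfl
    exact one_mem_points _ R

theorem mem_points_kernel {R : Type u} [CommRing R] [Algebra k R] (π : B →ₐc[k] A)
    (x : Points k A R) : x ∈ (kernel π).points R ↔ x.push π = 1 := by
  rw [kernel, mem_points_preimage, mem_points_trivial]

/-- The universal point of a closed subgroup scheme. -/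
noncomputable def univPoint (H : ClosedSubgroup k A) : Points k A (A ⧸ H.ideal) :=
  WithConv.toConv (Ideal.Quotient.mkₐ k H.ideal)

theorem univPoint_mem (H : ClosedSubgroup k A) : univPoint H ∈ H.points (A ⧸ H.ideal) :=
  fun _ ha => Ideal.Quotient.eq_zero_iff_mem.mpr ha

theorem map_mem_points (H : ClosedSubgroup k A) {R R' : Type u} [CommRing R] [Algebra k R]
    [CommRing R'] [Algebra k R'] (r : R →ₐ[k] R') {x : Points k A R} (hx : x ∈ H.points R) :
    x.map r ∈ H.points R' := fun a ha => by
  change r (x.ofConv a) = 0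
  rw [hx a ha, map_zero]

theorem Points.push_map {R R' : Type u} [CommRing R] [Algebra k R] [CommRing R'] [Algebra k R']
    (π : B →ₐc[k] A) (r : R →ₐ[k] R') (x : Points k A R) :
    (x.map r).push π = (x.push π).map r := rfl

variable [Algebra B A]

theorem ideal_preimage (π : B →ₐc[k] A) (hπ : ∀ b, algebraMap B A b = π b)
    (H' : ClosedSubgroup k B) : (preimage π H').ideal = H'.ideal.map (algebraMap B A) := by
  have : algebraMap B A = (π : B →ₐ[k] A).toRingHom := RingHom.ext hπ
  rw [this]
  rfl

theorem comap_ideal_preimage (π : B →ₐc[k] A) (hπ : ∀ b, algebraMap B A b = π b)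
    [Module.FaithfullyFlat B A] (H' : ClosedSubgroup k B) :
    (preimage π H').ideal.comap (π : B →ₐ[k] A) = H'.ideal := by
  conv_rhs => rw [← Ideal.comap_map_eq_self_of_faithfullyFlat (B := A) H'.ideal]
  rw [ideal_preimage π hπ]
  ext b
  rw [Ideal.mem_comap, Ideal.mem_comap, hπ]
  rfl

theorem image_preimage (π : B →ₐc[k] A) (hπ : ∀ b, algebraMap B A b = π b)
    [Module.FaithfullyFlat B A] (H' : ClosedSubgroup k B) : (preimage π H').image π = H' :=
  ClosedSubgroup.ext (comap_ideal_preimage π hπ H')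

/-- By faithful flatness k[H'] embeds in the coordinate ring of the preimage, so it inherits
geometric reducedness, which suffices for a group scheme of finite type. -/
theorem isSmooth_of_preimage (π : B →ₐc[k] A) (hπ : ∀ b, algebraMap B A b = π b)
    [Module.FaithfullyFlat B A] [Algebra.FiniteType k B] (H' : ClosedSubgroup k B)
    (h : (preimage π H').IsSmooth) : H'.IsSmooth := by
  have : Algebra.Smooth k (A ⧸ (preimage π H').ideal) := h
  have := isGeometricallyReduced_of_smooth k (A ⧸ (preimage π H').ideal)
  have := H'.isHopfIdeal
  have hle : H'.ideal ≤ (preimage π H').ideal.comap (π : B →ₐ[k] A) :=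
    (comap_ideal_preimage π hπ H').ge
  have : Algebra.IsGeometricallyReduced k (B ⧸ H'.ideal) :=
    .of_injective (Ideal.quotientMapₐ (preimage π H').ideal (π : B →ₐ[k] A) hle)
      (Ideal.quotientMap_injective' (H := hle) (comap_ideal_preimage π hπ H').le)
  have : Algebra.FiniteType k (B ⧸ H'.ideal) :=
    .of_surjective (Ideal.Quotient.mkₐ k H'.ideal) Ideal.Quotient.mk_surjective
  exact smooth_of_isGeometricallyReduced (A := B ⧸ H'.ideal)

variable [IsScalarTower k B A]

/-- `G × ker π ≃ G ×_{G'} G`, `(g, n) ↦ (g, g n)`. -/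
theorem nonempty_torsorEquiv (π : B →ₐc[k] A) (hπ : ∀ b, algebraMap B A b = π b) :
    Nonempty (A ⊗[k] (A ⧸ (kernel π).ideal) ≃ₐ[A] A ⊗[B] A) := by
  let N := kernel π
  -- x and y are the two projections of `G ×_{G'} G`. They agree in G', so x⁻¹ y is a point of ker
  -- π; below, u and v are the projections of `G × ker π`.
  let x : Points k A (A ⊗[B] A) :=
    WithConv.toConv ((Algebra.TensorProduct.includeLeft : A →ₐ[B] A ⊗[B] A).restrictScalars k)
  let y : Points k A (A ⊗[B] A) :=
    WithConv.toConv ((Algebra.TensorProduct.includeRight : A →ₐ[B] A ⊗[B] A).restrictScalars k)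
  have hxy : x.push π = y.push π := by
    apply WithConv.ofConv_injective
    ext b
    change (π b) ⊗ₜ[B] (1 : A) = 1 ⊗ₜ π b
    rw [← hπ, Algebra.algebraMap_eq_smul_one, TensorProduct.smul_tmul]
  have hN : x⁻¹ * y ∈ N.points (A ⊗[B] A) := by
    rw [mem_points_kernel, Points.push_mul, Points.push_inv, hxy, inv_mul_cancel]
  let n : (A ⧸ N.ideal) →ₐ[k] A ⊗[B] A := Ideal.Quotient.liftₐ N.ideal (x⁻¹ * y).ofConv hN
  have hn : (univPoint N).map n = x⁻¹ * y := by
    apply WithConv.ofConv_injective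
    ext a
    exact Ideal.Quotient.lift_mk N.ideal _ hN
  let u : Points k A (A ⊗[k] (A ⧸ N.ideal)) := WithConv.toConv Algebra.TensorProduct.includeLeft
  let v : Points k A (A ⊗[k] (A ⧸ N.ideal)) :=
    (univPoint N).map Algebra.TensorProduct.includeRight
  have hv : v.push π = 1 := (mem_points_kernel π v).mp (map_mem_points _ _ (univPoint_mem N))
  let uv : A →ₐ[B] A ⊗[k] (A ⧸ N.ideal) :=
    { (u * v).ofConv with
      commutes' := fun b => by
        have h : (u * v).push π = u.push π := by rw [Points.push_mul, hv, mul_one]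
        have h' := DFunLike.congr_fun (congrArg WithConv.ofConv h) b
        change (u * v).ofConv (algebraMap B A b) = algebraMap B A b ⊗ₜ 1
        rw [hπ]
        exact h' }
  let Ψ : A ⊗[k] (A ⧸ N.ideal) →ₐ[A] A ⊗[B] A :=
    Algebra.TensorProduct.lift (Algebra.ofId A _) n (fun _ _ => Commute.all _ _)
  let Θ : A ⊗[B] A →ₐ[A] A ⊗[k] (A ⧸ N.ideal) :=
    Algebra.TensorProduct.lift (Algebra.ofId A _) uv (fun _ _ => Commute.all _ _)
  have hΨu : u.map (Ψ.restrictScalars k) = x := by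
    apply WithConv.ofConv_injective
    ext a
    change Ψ (a ⊗ₜ 1) = a ⊗ₜ 1
    simp [Ψ]
  have hΨv : v.map (Ψ.restrictScalars k) = x⁻¹ * y := by
    rw [← hn]
    apply WithConv.ofConv_injective
    ext a
    change Ψ (1 ⊗ₜ Ideal.Quotient.mk N.ideal a) = n (Ideal.Quotient.mk N.ideal a)
    simp only [Ψ, Algebra.TensorProduct.lift_tmul, map_one, one_mul]
  have hΘx : x.map (Θ.restrictScalars k) = u := by
    apply WithConv.ofConv_injective
    ext a
    change Θ (a ⊗ₜ 1) = a ⊗ₜ 1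
    simp [Θ]
  have hΘy : y.map (Θ.restrictScalars k) = u * v := by
    apply WithConv.ofConv_injective
    ext a
    change Θ (1 ⊗ₜ a) = uv a
    simp only [Θ, Algebra.TensorProduct.lift_tmul, map_one, one_mul]
  refine ⟨AlgEquiv.ofAlgHom Ψ Θ ?_ ?_⟩
  · apply Algebra.TensorProduct.ext
    · ext
    · have h : y.map ((Ψ.restrictScalars k).comp (Θ.restrictScalars k)) = y := by
        change (y.map (Θ.restrictScalars k)).map (Ψ.restrictScalars k) = y
        rw [hΘy, Points.map_mul, hΨu, hΨv, mul_inv_cancel_left]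
      ext a
      exact DFunLike.congr_fun (congrArg WithConv.ofConv h) a
  · apply Algebra.TensorProduct.ext
    · ext
    · have h : v.map ((Θ.restrictScalars k).comp (Ψ.restrictScalars k)) = v := by
        change (v.map (Ψ.restrictScalars k)).map (Θ.restrictScalars k) = v
        rw [hΨv, Points.map_mul, Points.map_inv, hΘx, hΘy, inv_mul_cancel_left]
      apply Ideal.Quotient.algHom_ext
      ext a
      exact DFunLike.congr_fun (congrArg WithConv.ofConv h) a

/-- A faithfully flat morphism of group schemes with smooth kernel is smooth. -/
theorem smooth_of_kernel_isSmooth (π : B →ₐc[k] A) (hπ : ∀ b, algebraMap B A b = π b)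
    [Module.FaithfullyFlat B A] (hN : (kernel π).IsSmooth) : Algebra.Smooth B A := by
  obtain ⟨e⟩ := nonempty_torsorEquiv π hπ
  have : Algebra.Smooth k (A ⧸ (kernel π).ideal) := hN
  -- After base change along π itself, π becomes the projection `G × ker π → G`, which is smooth.
  have : Algebra.Smooth A (A ⊗[B] A) := .of_equiv e
  exact Algebra.Smooth.of_smooth_tensorProduct_of_faithfullyFlat A

/-- The map from the preimage to H' is a base change of π, hence smooth, and it is composed with H'
→ Spec k. -/
theorem preimage_isSmooth (π : B →ₐc[k] A) (hπ : ∀ b, algebraMap B A b = π b)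
    [Algebra.Smooth B A] (H' : ClosedSubgroup k B) (h : H'.IsSmooth) :
    (preimage π H').IsSmooth := by
  have : Algebra.Smooth k (B ⧸ H'.ideal) := h
  have : Algebra.Smooth k ((B ⧸ H'.ideal) ⊗[B] A) := .comp k (B ⧸ H'.ideal) _
  rw [IsSmooth, ideal_preimage π hπ]
  have : IsScalarTower k (B ⧸ H'.ideal) (A ⧸ H'.ideal.map (algebraMap B A)) :=
    .of_algebraMap_eq fun c => congrArg (Ideal.Quotient.mk _) (IsScalarTower.algebraMap_apply k B A c)
  exact .of_equiv ((Algebra.TensorProduct.quotIdealMapEquivQuotTensor A H'.ideal).symm.restrictScalars k)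

end Torsor

end AffGrp

namespace AffGrp

open AffGrp.ClosedSubgroup

/-! ### Infinitesimal rigidity of the kernel, and comparison of centralizers. -/

section Centralizer

variable {k A B : Type u} [Field k] [CommRing A] [HopfAlgebra k A] [CommRing B] [HopfAlgebra k B]

/-- The powers of x stabilize, so xⁿ = xⁿ⁺¹ y. Then x - x² y is nilpotent, hence zero. -/
theorem le_sq_of_isArtinianRing {Q : Type*} [CommRing Q] [IsArtinianRing Q] [IsReduced Q]
    (I : Ideal Q) : I ≤ I ^ 2 := by
  intro x hx
  obtain ⟨n, y, hy⟩ := IsArtinian.exists_pow_succ_smul_dvd x (1 : Q)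
  have hnil : IsNilpotent (x - x ^ 2 * y) := by
    refine ⟨n + 1, ?_⟩
    have h : x ^ n * (1 - x * y) = 0 := by
      simp only [smul_eq_mul, Nat.succ_eq_add_one, mul_one] at hy
      linear_combination -hy
    have : x - x ^ 2 * y = x * (1 - x * y) := by ring
    rw [this, mul_pow, pow_succ x, pow_succ (1 - x * y)]
    linear_combination x * (1 - x * y) ^ n * h
  rw [sub_eq_zero.mp hnil.eq_zero]
  exact Ideal.mul_mem_right _ _ (Ideal.pow_mem_pow hx 2)

/-- The cotangent space of a finite smooth kernel at the identity vanishes. -/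
theorem ker_counit_le (π : B →ₐc[k] A) (hfin : (kernel π).IsFinite) (hsm : (kernel π).IsSmooth) :
    RingHom.ker (Bialgebra.counitAlgHom k A) ≤
      RingHom.ker (Bialgebra.counitAlgHom k A) ^ 2 ⊔ (kernel π).ideal := by
  have : Algebra.Smooth k (A ⧸ (kernel π).ideal) := hsm
  have : Module.Finite k (A ⧸ (kernel π).ideal) := hfin
  have := isReduced_of_smooth k (A ⧸ (kernel π).ideal)
  have : IsArtinianRing (A ⧸ (kernel π).ideal) := IsArtinianRing.of_finite k _
  have h := le_sq_of_isArtinianRing ((RingHom.ker (Bialgebra.counitAlgHom k A)).map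
    (Ideal.Quotient.mk (kernel π).ideal))
  rw [← Ideal.map_pow, Ideal.map_le_iff_le_comap,
    Ideal.comap_map_of_surjective _ Ideal.Quotient.mk_surjective, ← RingHom.ker_eq_comap_bot,
    Ideal.mk_ker] at h
  exact h

/-- A point of the kernel that is infinitesimally close to the identity is the identity. -/
theorem eq_one_of_mem_kernel (π : B →ₐc[k] A) (hfin : (kernel π).IsFinite)
    (hsm : (kernel π).IsSmooth) {R : Type u} [CommRing R] [Algebra k R] (c : Ideal R)
    (hc : c ^ 2 = ⊥) (x : Points k A R) (hx : x.push π = 1)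
    (hx' : x.map (Ideal.Quotient.mkₐ k c) = 1) : x = 1 := by
  have h1 : (RingHom.ker (Bialgebra.counitAlgHom k A)).map x.ofConv ≤ c := by
    rw [Ideal.map_le_iff_le_comap]
    intro a ha
    have h := DFunLike.congr_fun (congrArg WithConv.ofConv hx') a
    rw [Ideal.mem_comap, ← Ideal.Quotient.eq_zero_iff_mem]
    refine h.trans ?_
    change algebraMap k _ (Bialgebra.counitAlgHom k A a) = 0
    rw [RingHom.mem_ker.mp ha, map_zero]
  -- The augmentation ideal lies in its square plus the ideal of ker π; x sends the former into c² =
  -- 0 and kills the latter.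
  have h2 : (RingHom.ker (Bialgebra.counitAlgHom k A)).map x.ofConv ≤ ⊥ := by
    refine (Ideal.map_mono (ker_counit_le π hfin hsm)).trans ?_
    rw [Ideal.map_sup, Ideal.map_pow, sup_le_iff]
    refine ⟨(Ideal.pow_right_mono h1 2).trans hc.le, ?_⟩
    rw [Ideal.map_le_iff_le_comap]
    exact fun a ha => (mem_points_kernel π x).mpr hx a ha
  refine (mem_points_trivial x).mp fun a ha => ?_
  exact (Submodule.mem_bot R).mp (h2 (Ideal.mem_map_of_mem _ ha))

theorem push_mem_points_image (π : B →ₐc[k] A) (H : ClosedSubgroup k A) {R : Type u} [CommRing R]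
    [Algebra k R] {h : Points k A R} (hh : h ∈ H.points R) : h.push π ∈ (H.image π).points R :=
  fun b hb => hh (π b) hb

theorem mulLeft_image (π : B →ₐc[k] A) (H : ClosedSubgroup k A) (b : B) :
    H.mulLeft (π b) = Algebra.TensorProduct.map (π : B →ₐ[k] A)
      (Ideal.quotientMapₐ H.ideal (π : B →ₐ[k] A) le_rfl :
        (B ⧸ (H.image π).ideal) →ₐ[k] (A ⧸ H.ideal)) ((H.image π).mulLeft b) := by
  have hΔ : Coalgebra.comul (π b) = Algebra.TensorProduct.map (π : B →ₐ[k] A)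
      (π : B →ₐ[k] A) (Coalgebra.comul b) :=
    (CoalgHomClass.map_comp_comul_apply π b).symm
  simp only [mulLeft, AlgHom.comp_apply, Bialgebra.comulAlgHom_apply, hΔ]
  simp only [← AlgHom.comp_apply]
  refine DFunLike.congr_fun (F := B ⊗[k] B →ₐ[k] A ⊗[k] (A ⧸ H.ideal)) ?_ _
  have hφ : ∀ x : B, (Ideal.quotientMapₐ H.ideal (π : B →ₐ[k] A) le_rfl :
      (B ⧸ (H.image π).ideal) →ₐ[k] (A ⧸ H.ideal)) (Ideal.Quotient.mk _ x) =
        Ideal.Quotient.mk _ (π x) := fun _ => rfl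
  generalize (Ideal.quotientMapₐ H.ideal (π : B →ₐ[k] A) le_rfl :
      (B ⧸ (H.image π).ideal) →ₐ[k] (A ⧸ H.ideal)) = φ at hφ ⊢
  ext <;> simp [hφ]

theorem mulRight_image (π : B →ₐc[k] A) (H : ClosedSubgroup k A) (b : B) :
    H.mulRight (π b) = Algebra.TensorProduct.map (π : B →ₐ[k] A)
      (Ideal.quotientMapₐ H.ideal (π : B →ₐ[k] A) le_rfl :
        (B ⧸ (H.image π).ideal) →ₐ[k] (A ⧸ H.ideal)) ((H.image π).mulRight b) := by
  have hΔ : Coalgebra.comul (π b) = Algebra.TensorProduct.map (π : B →ₐ[k] A)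
      (π : B →ₐ[k] A) (Coalgebra.comul b) :=
    (CoalgHomClass.map_comp_comul_apply π b).symm
  simp only [mulRight, AlgHom.comp_apply, Bialgebra.comulAlgHom_apply, hΔ]
  simp only [← AlgHom.comp_apply]
  refine DFunLike.congr_fun (F := B ⊗[k] B →ₐ[k] A ⊗[k] (A ⧸ H.ideal)) ?_ _
  have hφ : ∀ x : B, (Ideal.quotientMapₐ H.ideal (π : B →ₐ[k] A) le_rfl :
      (B ⧸ (H.image π).ideal) →ₐ[k] (A ⧸ H.ideal)) (Ideal.Quotient.mk _ x) =
        Ideal.Quotient.mk _ (π x) := fun _ => rfl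
  generalize (Ideal.quotientMapₐ H.ideal (π : B →ₐ[k] A) le_rfl :
      (B ⧸ (H.image π).ideal) →ₐ[k] (A ⧸ H.ideal)) = φ at hφ ⊢
  ext <;> simp [hφ]

/-- `π` maps the centralizer of `H` into the centralizer of `π H`. -/
theorem push_mem_centralizerPoints (π : B →ₐc[k] A) (H : ClosedSubgroup k A) {R : Type u}
    [CommRing R] [Algebra k R] {g : Points k A R} (hg : g ∈ H.centralizerPoints R) :
    g.push π ∈ (H.image π).centralizerPoints R := by
  rw [mem_centralizerPoints_iff_eq] at hg ⊢
  intro b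
  let φ : (B ⧸ (H.image π).ideal) →ₐ[k] (A ⧸ H.ideal) :=
    Ideal.quotientMapₐ H.ideal (π : B →ₐ[k] A) le_rfl
  have hφ : Function.Injective φ := Ideal.quotientMap_injective
  -- Points of πH need not lift to H. Instead k[πH] embeds in k[H], so the universal commutation
  -- relation can be tested in `R ⊗ k[H]`.
  have hinj : Function.Injective (Algebra.TensorProduct.map (AlgHom.id k R) φ) :=
    Module.Flat.lTensor_preserves_injective_linearMap φ.toLinearMap hφ
  apply hinj
  rw [map_zero, ← hg (π b), mulLeft_image, mulRight_image, ← map_sub]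
  simp only [← AlgHom.comp_apply]
  refine DFunLike.congr_fun (F := B ⊗[k] (B ⧸ (H.image π).ideal) →ₐ[k] R ⊗[k] (A ⧸ H.ideal)) ?_ _
  rw [← Algebra.TensorProduct.map_comp, ← Algebra.TensorProduct.map_comp]
  rfl

/-- The inclusion of C_G(H) in the preimage of C_{G'}(πH), read off from the universal point of
C_G(H). -/
theorem preimage_centralizer_le (π : B →ₐc[k] A) (H : ClosedSubgroup k A) :
    (preimage π (H.image π).centralizer).ideal ≤ H.centralizer.ideal := by
  intro a ha
  have h1 := univPoint_mem H.centralizer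
  rw [points_centralizer] at h1
  have h2 := push_mem_centralizerPoints π H h1
  rw [← points_centralizer, ← mem_points_preimage] at h2
  exact Ideal.Quotient.eq_zero_iff_mem.mp (h2 a ha)

/-- `C_G(H)` is open in `π⁻¹ C_{G'}(π H)`. -/
theorem centralizer_ideal_le (π : B →ₐc[k] A) (hfin : (kernel π).IsFinite)
    (hsm : (kernel π).IsSmooth) (H : ClosedSubgroup k A) :
    H.centralizer.ideal ≤
      H.centralizer.ideal ^ 2 ⊔ (preimage π (H.image π).centralizer).ideal := by
  -- K defines the first-order neighbourhood of C_G(H) in the preimage; it remains to see that its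
  -- universal point g centralizes H.
  let K := H.centralizer.ideal ^ 2 ⊔ (preimage π (H.image π).centralizer).ideal
  let g : Points k A (A ⧸ K) := WithConv.toConv (Ideal.Quotient.mkₐ k K)
  suffices hg : g ∈ H.centralizer.points (A ⧸ K) from
    fun a ha => Ideal.Quotient.eq_zero_iff_mem.mp (hg a ha)
  have hpush : g.push π ∈ (H.image π).centralizer.points (A ⧸ K) := by
    rw [← mem_points_preimage]
    exact fun a ha => Ideal.Quotient.eq_zero_iff_mem.mpr (Ideal.mem_sup_right ha)
  rw [points_centralizer] at hpush ⊢
  intro R' _ _ r h hh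
  let c : Ideal R' := H.centralizer.ideal.map (g.map r).ofConv
  have hc : c ^ 2 = ⊥ := by
    rw [← Ideal.map_pow, eq_bot_iff, Ideal.map_le_iff_le_comap]
    intro a ha
    rw [Ideal.mem_comap, Ideal.mem_bot]
    change r (Ideal.Quotient.mk K a) = 0
    rw [Ideal.Quotient.eq_zero_iff_mem.mpr (Ideal.mem_sup_left ha), map_zero]
  let q := Ideal.Quotient.mkₐ k c
  have hq : (g.map r).map q ∈ H.centralizer.points (R' ⧸ c) := fun a ha =>
    Ideal.Quotient.eq_zero_iff_mem.mpr (Ideal.mem_map_of_mem _ ha)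
  rw [points_centralizer] at hq
  -- The commutator dies in G' because π(g) centralizes πH, and dies modulo the square-zero ideal c
  -- because there g lies in C_G(H).
  have key : g.map r * h * (g.map r)⁻¹ * h⁻¹ = 1 := by
    refine eq_one_of_mem_kernel π hfin hsm c hc _ ?_ ?_
    · have := hpush R' r (h.push π) (push_mem_points_image π H hh)
      rw [← Points.push_map] at this
      rw [Points.push_mul, Points.push_mul, Points.push_mul, Points.push_inv, Points.push_inv,
        this, mul_inv_cancel_right, mul_inv_cancel]
    · have : (g.map r).map q * h.map q = h.map q * (g.map r).map q :=
        hq (R' ⧸ c) (AlgHom.id k _) (h.map q) (map_mem_points H q hh)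
      rw [Points.map_mul, Points.map_mul, Points.map_mul, Points.map_inv, Points.map_inv,
        this, mul_inv_cancel_right, mul_inv_cancel]
  rw [mul_inv_eq_one, mul_inv_eq_iff_eq_mul] at key
  exact key

theorem ideal_ne_top (H : ClosedSubgroup k A) : H.ideal ≠ ⊤ := fun h => by
  have := H.isHopfIdeal.counit_eq_zero (show (1 : A) ∈ H.ideal from h ▸ Submodule.mem_top)
  simp at this

/-- Smoothness of a closed subgroup scheme is the same as that of an open subgroup scheme. -/
theorem isSmooth_iff_of_le_sq_sup [Algebra.FiniteType k A] (C M : ClosedSubgroup k A)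
    (hle : M.ideal ≤ C.ideal) (hsq : C.ideal ≤ C.ideal ^ 2 ⊔ M.ideal) :
    C.IsSmooth ↔ M.IsSmooth := by
  have := M.isHopfIdeal
  have : Algebra.FiniteType k (A ⧸ M.ideal) :=
    .of_surjective (Ideal.Quotient.mkₐ k M.ideal) Ideal.Quotient.mk_surjective
  have : IsNoetherianRing (A ⧸ M.ideal) := Algebra.FiniteType.isNoetherianRing k _
  let I : Ideal (A ⧸ M.ideal) := C.ideal.map (Ideal.Quotient.mkₐ k M.ideal)
  let e : ((A ⧸ M.ideal) ⧸ I) ≃ₐ[k] A ⧸ C.ideal := DoubleQuot.quotQuotEquivQuotOfLEₐ k hle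
  -- Modulo the ideal of M, the hypothesis `hsq` says I ≤ I².
  have hI : IsIdempotentElem I := by
    refine le_antisymm Ideal.mul_le_left ?_
    rw [← pow_two]
    refine (Ideal.map_mono hsq).trans ?_
    rw [Ideal.map_sup, Ideal.map_pow]
    refine sup_le le_rfl ?_
    rw [Ideal.map_le_iff_le_comap]
    intro a ha
    have : Ideal.Quotient.mkₐ k M.ideal a = 0 := Ideal.Quotient.eq_zero_iff_mem.mpr ha
    rw [Ideal.mem_comap, this]
    exact Ideal.zero_mem _
  constructor
  · intro h
    have : Algebra.Smooth k (A ⧸ C.ideal) := h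
    have : Algebra.Smooth k ((A ⧸ M.ideal) ⧸ I) := .of_equiv e.symm
    refine smooth_of_smooth_quotient I hI fun htop => ideal_ne_top C ?_
    rw [← Ideal.Quotient.subsingleton_iff] at htop ⊢
    exact e.symm.injective.subsingleton
  · intro h
    have : Algebra.Smooth k (A ⧸ M.ideal) := h
    -- A quotient is formally smooth exactly when its kernel is idempotent.
    have : Algebra.FormallySmooth (A ⧸ M.ideal) ((A ⧸ M.ideal) ⧸ I) := by
      rw [Algebra.FormallySmooth.iff_of_surjective Ideal.Quotient.mk_surjective,
        Ideal.Quotient.algebraMap_eq, Ideal.mk_ker]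
      exact hI
    have : Algebra.FinitePresentation (A ⧸ M.ideal) ((A ⧸ M.ideal) ⧸ I) :=
      .quotient (IsNoetherian.noetherian I)
    have : Algebra.Smooth (A ⧸ M.ideal) ((A ⧸ M.ideal) ⧸ I) := ⟨‹_›, ‹_›⟩
    have : Algebra.Smooth k ((A ⧸ M.ideal) ⧸ I) := .comp k (A ⧸ M.ideal) _
    exact .of_equiv e

end Centralizer

end AffGrp

/-! ### The main theorem. -/

theorem lemma3p8 {k A B : Type u} [Field k]
    [CommRing A] [HopfAlgebra k A] [Algebra.FiniteType k A] [Algebra.Smooth k A]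
    [CommRing B] [HopfAlgebra k B] [Algebra.FiniteType k B] [Algebra.Smooth k B]
    (π : B →ₐc[k] A) (isogeny : AffGrp.IsIsogeny π) (central : AffGrp.IsCentral π)
    (separable : AffGrp.IsSeparable π) :
    (∀ H : AffGrp.ClosedSubgroup k A,
      H.centralizer.IsSmooth ↔ (H.image π).centralizer.IsSmooth) ∧
    ((∀ H : AffGrp.ClosedSubgroup k A, H.centralizer.IsSmooth) ↔
      ∀ H' : AffGrp.ClosedSubgroup k B, H'.centralizer.IsSmooth) := by
  let : Algebra B A := (π : B →ₐ[k] A).toRingHom.toAlgebra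
  have hπ : ∀ b, algebraMap B A b = π b := fun _ => rfl
  have : IsScalarTower k B A := .of_algebraMap_eq fun c => ((π : B →ₐ[k] A).commutes c).symm
  have : IsReduced B := AffGrp.isReduced_of_smooth k B
  have : IsNoetherianRing B := Algebra.FiniteType.isNoetherianRing k B
  have : Module.FaithfullyFlat B A := AffGrp.faithfullyFlat_of_injective π hπ isogeny.injective
  have : Algebra.Smooth B A := AffGrp.smooth_of_kernel_isSmooth π hπ separable
  have main : ∀ H : AffGrp.ClosedSubgroup k A,
      H.centralizer.IsSmooth ↔ (H.image π).centralizer.IsSmooth := fun H =>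
    (AffGrp.isSmooth_iff_of_le_sq_sup _ _ (AffGrp.preimage_centralizer_le π H)
      (AffGrp.centralizer_ideal_le π isogeny.finite_kernel separable H)).trans
      ⟨AffGrp.isSmooth_of_preimage π hπ _, AffGrp.preimage_isSmooth π hπ _⟩
  -- By faithful flatness H' is the image of its preimage, so the first claim reaches every subgroup
  -- of G'.
  refine ⟨main, fun h H' => ?_, fun h H => (main H).mpr (h _)⟩
  have := (main (AffGrp.ClosedSubgroup.preimage π H')).mp (h _)
  rwa [AffGrp.image_preimage π hπ] at this
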